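/- Let $\lambda\neq 0$ be an algebraic number none of whose Galois conjugates lies on the unit circle, i.e. $|\sigma(\lambda)|\neq 1$ for every field embedding $\sigma:K\to\mathbb{C}$, where $K=\mathbb{Q}(\lambda)$. Let $\mu$ be a finitely supported probability measure on $\mathbb{Z}$, let $\xi_0,\xi_1,\dots$ be independent random variables with law $\mu$, and put $X_n=\sum_{j=0}^{n-1}\xi_j\lambda^j\in K$. Let $$h_\lambda(\mu)=\lim_{n\to\infty}\frac{H(X_n)}{n},\qquad H(X)=-\sum_x\mathbb{P}(X=x)\log\mathbb{P}(X=x),$$ be the Garsia entropy, and let $$M_\lambda=|a_d|\prod_{\sigma:K\to\mathbb{C},\ |\sigma(\lambda)|>1}|\sigma(\lambda)|$$ be the Mahler measure, where $a_d$ is the leading coefficient of the minimal polynomial of $\lambda$ over $\mathbb{Z}$ (the primitive integer multiple of its minimal polynomial over $\mathbb{Q}$). Let $$A_\lambda=\prod_{v:\ |\lambda|_v<1}K_v$$ be the contraction space, the product of the completions of $K$ at all places $v$ (Archimedean and non-Archimedean) with $|\lambda|_v<1$, with the product topology and a Haar measure $dx$ for addition. Embed $K$ diagonally in $A_\lambda$.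 Then $X_n$ converges almost surely in $A_\lambda$ to a random variable $X_\lambda$, and if $h_\lambda(\mu)=\log M_\lambda$, then the law of $X_\lambda$ is absolutely continuous with respect to $dx$ with bounded density. -/

import Mathlib

open Filter Topology MeasureTheory ProbabilityTheory NumberField IsDedekindDomain
open scoped NNReal ENNReal nonZeroDivisors

namespace MaxEntropy

section

variable {K : Type*} [Field K] [NumberField K]

/-- The minimal polynomial of `lam` over `ℤ`: the primitive integer multiple of the monic minimal
polynomial over `ℚ` (well defined up to sign, which plays no role below). -/
noncomputable def intMinpoly (lam : K) : Polynomial ℤ :=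
  (IsLocalization.integerNormalization ℤ⁰ (minpoly ℚ lam)).primPart

open scoped Classical in
/-- The Mahler measure `M = |a_d| ∏_{|σ(lam)| > 1} |σ(lam)|` of a generator `lam` of `K = ℚ(lam)`,
where `a_d` is the leading coefficient of the minimal polynomial over `ℤ` and `σ` ranges over the
field embeddings `K → ℂ`. -/
noncomputable def mahler (lam : K) : ℝ :=
  |((intMinpoly lam).leadingCoeff : ℝ)| *
    ∏ σ : K →+* ℂ with 1 < ‖σ lam‖, ‖σ lam‖

/-- The Archimedean places `v` of `K` with `|lam|_v < 1`. -/
abbrev InfContr (lam : K) : Type _ := {v : InfinitePlace K // v lam < 1}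

/-- The non-Archimedean places `v` of `K` with `|lam|_v < 1`. -/
abbrev FinContr (lam : K) : Type _ :=
  {v : HeightOneSpectrum (𝓞 K) // HeightOneSpectrum.adicAbv K v lam < 1}

/-- The contraction space `A_lam = ∏_v K_v`, the product over all places `v` of `K` with
`|lam|_v < 1` (the Archimedean ones in the first factor, the others in the second one), with
componentwise operations and the product topology. -/
abbrev ContractionSpace (lam : K) : Type _ :=
  ((v : InfContr lam) → v.1.Completion) × ((v : FinContr lam) → v.1.adicCompletion K)

/-- The contraction space carries its Borel `σ`-algebra. -/
noncomputable instance (lam : K) : MeasurableSpace (ContractionSpace lam) := borel _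

instance (lam : K) : BorelSpace (ContractionSpace lam) := ⟨rfl⟩

/-- The diagonal embedding `K → A_lam`. -/
noncomputable def diag (lam x : K) : ContractionSpace lam :=
  (fun v => algebraMap K v.1.Completion x, fun v => algebraMap K (v.1.adicCompletion K) x)

/-- `X_n = ∑_{j < n} ξ_j lam ^ j`, as a function of the sequence `ξ`. -/
noncomputable def partialSum (lam : K) (ξ : ℕ → ℤ) (n : ℕ) : K :=
  ∑ j ∈ Finset.range n, (ξ j : K) * lam ^ j

/-- `X_lam = lim X_n ∈ A_lam`, as a function of the sequence `ξ`. -/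
noncomputable def limitSum (lam : K) (ξ : ℕ → ℤ) : ContractionSpace lam :=
  limUnder atTop fun n => diag lam (partialSum lam ξ n)

end

/-- The Shannon entropy `H(X) = - ∑_x ℙ(X = x) log ℙ(X = x)` of a random variable with finitely
many values. -/
noncomputable def shannonEntropy {Ω E : Type*} [MeasurableSpace Ω] (P : Measure Ω) (X : Ω → E) :
    ℝ :=
  ∑' x : E, Real.negMulLog (P.real (X ⁻¹' {x}))

/-- `h` is the Garsia entropy `lim H(X_n) / n`, where `X_n = ∑_{j < n} ξ_j lam ^ j`. -/
def IsGarsiaEntropy {K Ω : Type*} [Field K] [NumberField K] [MeasurableSpace Ω] (P : Measure Ω)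
    (lam : K) (ξ : ℕ → Ω → ℤ) (h : ℝ) : Prop :=
  Tendsto (fun n : ℕ => shannonEntropy P (fun ω => partialSum lam (fun j => ξ j ω) n) / n)
    atTop (𝓝 h)

end MaxEntropy

/-! Put `lam' = lam⁻¹`, let `A`, `A'` be the contraction spaces of `lam` and `lam'`, and let `Λ` be
the elements of `K` integral at every finite place where `|lam|_v = 1`. Since no Archimedean
absolute value of `lam` is 1, every Archimedean place, and every finite one where `Λ` may have
denominators, occurs in `A` or in `A'`. So the diagonal image of `Λ` in `A × A'` has finitely many
points in each compact set (`finite_diagPair_preimage`), and multiplication by `lam` is a hyperbolic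
automorphism preserving it.

Absolute continuity (`map_absolutelyContinuous_of_entropy`). The limit is `X_n + lam ^ n * X'`,
where `X'` is the limit of the shifted digits. Here `X_n` lies in `Λ`, and `lam ^ (-n) * X_n` stays
bounded in `A'` by reversing the digits. Multiplication by `lam ^ n` shrinks volume by at most `M ^
n`, so a volume comparison leaves `O(M ^ n)` values for `X_n`, and only `O(ε M ^ n)` of them near a
set with a neighbourhood of volume `ε`. Were a null set charged with mass `δ`, the entropy of `X_n`
would drop below `n log M` once `ε` is small against `δ`. But subadditivity and the hypothesis give
`H(X_n) ≥ n log M`. The same applies to `lam'`: reversing digits preserves entropy, and `M` can be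
written with either end coefficient of the minimal polynomial.

Boundedness (`map_limitSum_le_smul`). Let `m` be the product of the law of `X_lam` with that of
`-lam' * X_lam'`, the past of a two-sided sequence. Moving one digit across the origin shows that
`m` and `lam * m` are mixtures of the same pieces, translated by amounts differing by elements of
`Λ`. Hence the sum `ρ` of all `Λ`-translates of `m` is invariant under `lam`. As `m` has an `L¹`
density, a Hopf argument (`exists_le_smul_of_periodization_invariant`) makes `ρ` invariant under
contracted translations, and under expanded ones by applying the inverse. So `ρ` is a multiple of
Haar measure, `m ≤ ρ`, and the bound passes to the first factor. -/

namespace MaxEntropy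

/-! ### Sums of lattice translates of a measure -/

section Periodization

variable {Λ G : Type*} [AddCommGroup Λ] [AddCommGroup G] [MeasurableSpace G] [MeasurableAdd G]

/-- The sum of all translates of a measure by the elements of a group mapping to `G`. -/
noncomputable def periodization (i : Λ →+ G) (m : Measure G) : Measure G :=
  Measure.sum fun γ => m.map (· + i γ)

lemma periodization_apply (i : Λ →+ G) (m : Measure G) {S : Set G} (hS : MeasurableSet S) :
    periodization i m S = ∑' γ, m ((· + i γ) ⁻¹' S) := by
  rw [periodization, Measure.sum_apply _ hS]
  exact tsum_congr fun γ => Measure.map_apply (measurable_add_const _) hS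

omit [MeasurableAdd G] in
lemma le_periodization (i : Λ →+ G) (m : Measure G) : m ≤ periodization i m := by
  refine le_trans (le_of_eq ?_) (Measure.le_sum _ (0 : Λ))
  simp

lemma periodization_map_add (i : Λ →+ G) (m : Measure G) (δ : Λ) :
    periodization i (m.map (· + i δ)) = periodization i m := by
  ext S hS
  rw [periodization_apply i _ hS, periodization_apply i _ hS,
    ← (Equiv.addLeft δ).tsum_eq fun γ => m ((· + i γ) ⁻¹' S)]
  refine tsum_congr fun γ => ?_
  rw [Measure.map_apply (measurable_add_const _) (measurable_add_const _ hS)]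
  congr 1
  ext z
  simp [add_assoc]

lemma periodization_sum {ι : Type*} (i : Λ →+ G) (m : ι → Measure G) :
    periodization i (Measure.sum m) = Measure.sum fun k => periodization i (m k) := by
  ext S hS
  rw [periodization_apply i _ hS, Measure.sum_apply _ hS]
  simp_rw [periodization_apply i _ hS]
  rw [ENNReal.tsum_comm]
  exact tsum_congr fun γ => Measure.sum_apply _ (measurable_add_const _ hS)

lemma periodization_smul (i : Λ →+ G) (c : ℝ≥0∞) (m : Measure G) :
    periodization i (c • m) = c • periodization i m := by
  ext S hS
  rw [periodization_apply i _ hS, Measure.smul_apply, periodization_apply i _ hS, smul_eq_mul,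
    ← ENNReal.tsum_mul_left]
  rfl

lemma map_periodization (i : Λ →+ G) (m : Measure G) (Θ : G →+ G) (hΘ : Measurable Θ)
    (θ : Λ ≃ Λ) (h : ∀ γ, Θ (i γ) = i (θ γ)) :
    (periodization i m).map Θ = periodization i (m.map Θ) := by
  ext S hS
  rw [Measure.map_apply hΘ hS, periodization_apply i _ (hΘ hS), periodization_apply i _ hS,
    ← θ.tsum_eq fun γ => (m.map Θ) ((· + i γ) ⁻¹' S)]
  refine tsum_congr fun γ => ?_
  rw [Measure.map_apply hΘ (measurable_add_const _ hS)]
  congr 1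
  ext z
  simp [h]

end Periodization

/-! ### The Hopf argument: invariance under hyperbolic automorphisms forces Haar measure -/

section Translation

variable {G : Type*} [AddCommGroup G] [TopologicalSpace G] [IsTopologicalAddGroup G]
  [LocallyCompactSpace G] [T2Space G] [SecondCountableTopology G] [MeasurableSpace G]
  [BorelSpace G]

/-- Translation is continuous in `L¹`. -/
lemma tendsto_lintegral_translate_sub (dx : Measure G) [dx.IsAddHaarMeasure] {f : G → ℝ≥0∞}
    (hf : Measurable f) (hfi : ∫⁻ z, f z ∂dx ≠ ∞) :
    Tendsto (fun b => ∫⁻ z, (f (z - b) - f z) ∂dx) (𝓝 0) (𝓝 0) := by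
  have hF : MemLp (fun z => (f z).toReal) 1 dx :=
    memLp_one_iff_integrable.2 (integrable_toReal_of_lintegral_ne_top hf.aemeasurable hfi)
  have hfin : ∀ᵐ z ∂dx, f z < ∞ := ae_lt_top hf hfi
  let τ : C(G, C(G, G)) := (ContinuousMap.mk (fun q : G × G => q.2 - q.1) (by fun_prop)).curry
  have hτ : ∀ b, MeasurePreserving (τ b) dx dx := fun b => measurePreserving_sub_right dx b
  have key : Tendsto (fun b => Lp.compMeasurePreserving (τ b) (hτ b) (hF.toLp _)) (𝓝 0)
      (𝓝 (Lp.compMeasurePreserving (τ 0) (hτ 0) (hF.toLp _))) :=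
    tendsto_const_nhds.compMeasurePreservingLp (τ.continuous.tendsto 0) hτ (hτ 0) (by simp)
  have h0 : Lp.compMeasurePreserving (τ 0) (hτ 0) (hF.toLp _) = hF.toLp _ := by
    rw [Lp.toLp_compMeasurePreserving hF (hτ 0)]
    congr 1
    ext z
    simp [τ]
  rw [h0, tendsto_iff_edist_tendsto_0] at key
  -- The truncated difference is the positive part, so its integral is at most the `L¹` distance.
  refine tendsto_of_tendsto_of_tendsto_of_le_of_le tendsto_const_nhds key (fun _ => zero_le) ?_
  intro b
  have e : edist (Lp.compMeasurePreserving (τ b) (hτ b) (hF.toLp _)) (hF.toLp _)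
      = ∫⁻ z, ‖(f (z - b)).toReal - (f z).toReal‖ₑ ∂dx := by
    rw [Lp.toLp_compMeasurePreserving hF (hτ b), Lp.edist_toLp_toLp, eLpNorm_one_eq_lintegral_enorm]
    rfl
  simp only [e]
  refine lintegral_mono_ae ?_
  filter_upwards [hfin, (hτ b).quasiMeasurePreserving.ae hfin] with z h1 h2
  replace h2 : f (z - b) < ∞ := h2
  rw [tsub_le_iff_right]
  calc f (z - b) = ENNReal.ofReal ((f (z - b)).toReal) := (ENNReal.ofReal_toReal h2.ne).symm
    _ ≤ ENNReal.ofReal (|(f (z - b)).toReal - (f z).toReal| + (f z).toReal) := by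
        apply ENNReal.ofReal_le_ofReal
        linarith [le_abs_self ((f (z - b)).toReal - (f z).toReal)]
    _ = _ := by
        rw [ENNReal.ofReal_add (abs_nonneg _) ENNReal.toReal_nonneg, ENNReal.ofReal_toReal h1.ne,
          ← Real.norm_eq_abs, ofReal_norm]

variable {Λ : Type*} [AddCommGroup Λ]

/-- A set meets every coset of the image of `i` in at most `N` points. -/
def HasMultiplicityLE (i : Λ →+ G) (S : Set G) (N : ℝ≥0∞) : Prop :=
  ∀ z, ∑' γ, S.indicator (1 : G → ℝ≥0∞) (z + i γ) ≤ N

omit [TopologicalSpace G] [IsTopologicalAddGroup G] [LocallyCompactSpace G] [T2Space G]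
  [SecondCountableTopology G] [MeasurableSpace G] [BorelSpace G] in
lemma HasMultiplicityLE.mono {i : Λ →+ G} {S T : Set G} {N : ℝ≥0∞}
    (h : HasMultiplicityLE i T N) (hST : S ⊆ T) : HasMultiplicityLE i S N := fun z =>
  (ENNReal.tsum_le_tsum fun _ => Set.indicator_le_indicator_of_subset hST (by simp) _).trans (h z)

omit [LocallyCompactSpace G] [T2Space G] [SecondCountableTopology G] in
-- Substituting `z - b` puts the shift `b` on the density and leaves the indicator free of it, so
-- that the indicators can later be summed over the lattice.
lemma measure_preimage_add_eq_lintegral (dx : Measure G) [dx.IsAddHaarMeasure] (f : G → ℝ≥0∞)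
    {S : Set G} (hS : MeasurableSet S) (c b : G) :
    dx.withDensity f ((· + (c + b)) ⁻¹' S) =
      ∫⁻ z, f (z - b) * S.indicator (1 : G → ℝ≥0∞) (z + c) ∂dx := by
  rw [withDensity_apply _ (measurable_add_const _ hS), ← lintegral_indicator
    (measurable_add_const _ hS), ← lintegral_sub_right_eq_self _ b]
  refine lintegral_congr fun z => ?_
  have e : z - b + (c + b) = z + c := by abel
  by_cases h : z + c ∈ S <;> simp [Set.indicator, e, h]

variable [Countable Λ]

omit [LocallyCompactSpace G] [T2Space G] [SecondCountableTopology G] in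
-- Bound `f (z - b)` by `f z` plus the positive part of the difference. The excess is integrated
-- against the number of lattice translates of `z` in `S`, which is at most `N`.
lemma periodization_preimage_add_le (dx : Measure G) [dx.IsAddHaarMeasure] {f : G → ℝ≥0∞}
    (hf : Measurable f) (i : Λ →+ G) {S : Set G} (hS : MeasurableSet S) {N : ℝ≥0∞}
    (hN : HasMultiplicityLE i S N) (b : G) :
    periodization i (dx.withDensity f) ((· + b) ⁻¹' S) ≤
      periodization i (dx.withDensity f) S + N * ∫⁻ z, (f (z - b) - f z) ∂dx := by
  have hind : Measurable (S.indicator (1 : G → ℝ≥0∞)) := measurable_one.indicator hS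
  have hi : ∀ γ, Measurable fun z => S.indicator (1 : G → ℝ≥0∞) (z + i γ) := fun γ =>
    hind.comp (measurable_add_const _)
  have hd : Measurable fun z => f (z - b) - f z := (hf.comp (measurable_sub_const b)).sub hf
  rw [periodization_apply i _ (measurable_add_const _ hS), periodization_apply i _ hS]
  calc ∑' γ, dx.withDensity f ((· + i γ) ⁻¹' ((· + b) ⁻¹' S))
      = ∑' γ, ∫⁻ z, f (z - b) * S.indicator (1 : G → ℝ≥0∞) (z + i γ) ∂dx := by
        refine tsum_congr fun γ => ?_
        rw [← measure_preimage_add_eq_lintegral dx f hS]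
        congr 1
        ext z
        simp [add_assoc]
    _ ≤ ∑' γ, (∫⁻ z, f z * S.indicator (1 : G → ℝ≥0∞) (z + i γ) ∂dx +
          ∫⁻ z, (f (z - b) - f z) * S.indicator (1 : G → ℝ≥0∞) (z + i γ) ∂dx) := by
        refine ENNReal.tsum_le_tsum fun γ => ?_
        rw [← lintegral_add_left (f := fun z => f z * S.indicator (1 : G → ℝ≥0∞) (z + i γ))
          (hf.mul (hi γ))]
        refine lintegral_mono fun z => ?_
        rw [← add_mul]
        gcongr
        exact le_add_tsub
    _ = ∑' γ, ∫⁻ z, f z * S.indicator (1 : G → ℝ≥0∞) (z + i γ) ∂dx +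
          ∫⁻ z, (f (z - b) - f z) * ∑' γ, S.indicator (1 : G → ℝ≥0∞) (z + i γ) ∂dx := by
        rw [ENNReal.tsum_add, ← lintegral_tsum (f := fun γ z => (f (z - b) - f z) *
          S.indicator (1 : G → ℝ≥0∞) (z + i γ)) fun γ => (hd.mul (hi γ)).aemeasurable]
        simp_rw [ENNReal.tsum_mul_left]
    _ ≤ _ := by
        gcongr with γ
        · have := measure_preimage_add_eq_lintegral dx f hS (i γ) 0
          simp only [add_zero, sub_zero] at this
          exact this.ge
        · rw [← lintegral_const_mul _ hd]
          refine lintegral_mono fun z => ?_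
          rw [mul_comm N]
          gcongr
          exact hN z

/-- An absolutely continuous periodization that is invariant under automorphisms contracting `a`
is invariant under translation by `a`. -/
lemma periodization_preimage_add_le_self (dx : Measure G) [dx.IsAddHaarMeasure] (m : Measure G)
    [IsFiniteMeasure m] (hm : m ≪ dx) (i : Λ →+ G) {S : Set G} (hS : MeasurableSet S) {N : ℝ≥0∞}
    (hNt : N ≠ ∞) (hN : HasMultiplicityLE i S N) (Θ : ℕ → G ≃ₜ+ G) (θ : ℕ → Λ ≃ Λ)
    (hθ : ∀ n γ, Θ n (i γ) = i (θ n γ))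
    (hinv : ∀ n, (periodization i m).map (Θ n) = periodization i m)
    {a : G} (ha : Tendsto (fun n => Θ n a) atTop (𝓝 0)) :
    periodization i m ((· + a) ⁻¹' S) ≤ periodization i m S := by
  obtain ⟨f, hf, rfl⟩ : ∃ f, Measurable f ∧ dx.withDensity f = m :=
    ⟨_, Measure.measurable_rnDeriv m dx, Measure.withDensity_rnDeriv_eq _ _ hm⟩
  have hfi : ∫⁻ z, f z ∂dx ≠ ∞ := by
    have := measure_ne_top (dx.withDensity f) Set.univ
    rwa [withDensity_apply _ MeasurableSet.univ, setLIntegral_univ] at this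
  have hmeas : ∀ n, Measurable (Θ n) := fun n => (Θ n).continuous.measurable
  have hsymm : ∀ n, Measurable (Θ n).symm := fun n => (Θ n).symm.continuous.measurable
  have hpre : ∀ n T, MeasurableSet T → periodization i (dx.withDensity f) (Θ n ⁻¹' T) =
      periodization i (dx.withDensity f) T := fun n T hT => by
    rw [← Measure.map_apply (hmeas n) hT, hinv]
  -- Invariance under `Θ n` replaces `S` by its image and the shift `a` by `Θ n a`, which tends to
  -- 0, while the multiplicity bound `N` stays the same because `Θ n` permutes the lattice.
  have hle : ∀ n, periodization i (dx.withDensity f) ((· + a) ⁻¹' S) ≤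
      periodization i (dx.withDensity f) S + N * ∫⁻ z, (f (z - Θ n a) - f z) ∂dx := by
    intro n
    have hSn : MeasurableSet ((Θ n).symm ⁻¹' S) := hsymm n hS
    have e1 : (· + a) ⁻¹' S = Θ n ⁻¹' ((· + Θ n a) ⁻¹' ((Θ n).symm ⁻¹' S)) := by
      ext z; simp
    have e2 : S = Θ n ⁻¹' ((Θ n).symm ⁻¹' S) := by ext z; simp
    have hNn : HasMultiplicityLE i ((Θ n).symm ⁻¹' S) N := by
      intro z
      rw [← (θ n).tsum_eq]
      refine le_trans (le_of_eq (tsum_congr fun γ => ?_)) (hN ((Θ n).symm z))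
      rw [← hθ]
      have e : z + Θ n (i γ) ∈ (Θ n).symm ⁻¹' S ↔ (Θ n).symm z + i γ ∈ S := by simp
      by_cases h : (Θ n).symm z + i γ ∈ S
      · rw [Set.indicator_of_mem (e.2 h), Set.indicator_of_mem h]
        simp
      · rw [Set.indicator_of_notMem (mt e.1 h), Set.indicator_of_notMem h]
    conv_rhs => rw [e2]
    rw [e1, hpre n _ (measurable_add_const _ hSn), hpre n _ hSn]
    exact periodization_preimage_add_le dx hf i hSn hNn _
  have hlim : Tendsto (fun n => periodization i (dx.withDensity f) S +
      N * ∫⁻ z, (f (z - Θ n a) - f z) ∂dx) atTop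
      (𝓝 (periodization i (dx.withDensity f) S + N * 0)) :=
    (ENNReal.Tendsto.const_mul ((tendsto_lintegral_translate_sub dx hf hfi).comp ha)
      (Or.inr hNt)).const_add _
  simpa using ge_of_tendsto' hlim hle

/-- The one-sided inequality for `a` and for `-a` gives equality on subsets of a compact set, where
the multiplicity is finite; a compact covering does the rest. -/
lemma periodization_map_add_right_eq (dx : Measure G) [dx.IsAddHaarMeasure] (m : Measure G)
    [IsFiniteMeasure m] (hm : m ≪ dx) (i : Λ →+ G)
    (hN : ∀ Q : Set G, IsCompact Q → ∃ N : ℝ≥0∞, N ≠ ∞ ∧ HasMultiplicityLE i Q N)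
    (Θ : ℕ → G ≃ₜ+ G) (θ : ℕ → Λ ≃ Λ) (hθ : ∀ n γ, Θ n (i γ) = i (θ n γ))
    (hinv : ∀ n, (periodization i m).map (Θ n) = periodization i m)
    {a : G} (ha : Tendsto (fun n => Θ n a) atTop (𝓝 0)) :
    (periodization i m).map (· + a) = periodization i m := by
  have ha' : Tendsto (fun n => Θ n (-a)) atTop (𝓝 0) := by
    simpa using ha.neg
  have hQ : ∀ Q : Set G, IsCompact Q → ∀ S ⊆ Q, MeasurableSet S →
      periodization i m ((· + a) ⁻¹' S) = periodization i m S := by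
    intro Q hQ S hSQ hS
    obtain ⟨N, hNt, hNQ⟩ := hN Q hQ
    refine le_antisymm (periodization_preimage_add_le_self dx m hm i hS hNt (hNQ.mono hSQ) Θ θ hθ
      hinv ha) ?_
    have hN' : HasMultiplicityLE i ((· + a) ⁻¹' S) N := by
      intro z
      refine le_trans (le_of_eq (tsum_congr fun γ => ?_)) (hNQ.mono hSQ (z + a))
      rw [add_right_comm z a]
      rfl
    have := periodization_preimage_add_le_self dx m hm i (measurable_add_const a hS) hNt hN' Θ θ hθ
      hinv ha'
    simpa [← Set.preimage_comp, Function.comp_def] using this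
  refine Measure.ext_of_iUnion_eq_univ (s := compactCovering G) (iUnion_compactCovering G) ?_
  intro n
  ext S hS
  have hc := (isCompact_compactCovering G n)
  rw [Measure.restrict_apply hS, Measure.restrict_apply hS, Measure.map_apply
    (measurable_add_const a) (hS.inter hc.measurableSet)]
  exact hQ _ hc _ Set.inter_subset_right (hS.inter hc.measurableSet)

omit [LocallyCompactSpace G] [T2Space G] [SecondCountableTopology G] in
lemma periodization_lt_top_of_hasMultiplicityLE (i : Λ →+ G) (m : Measure G) [IsFiniteMeasure m]
    {S : Set G} (hS : MeasurableSet S) {N : ℝ≥0∞} (hNt : N ≠ ∞) (hN : HasMultiplicityLE i S N) :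
    periodization i m S < ∞ := by
  rw [periodization_apply i _ hS]
  calc ∑' γ, m ((· + i γ) ⁻¹' S)
      = ∑' γ, ∫⁻ z, S.indicator (1 : G → ℝ≥0∞) (z + i γ) ∂m := by
        refine tsum_congr fun γ => ?_
        rw [← lintegral_indicator_one (measurable_add_const _ hS)]
        rfl
    _ = ∫⁻ z, ∑' γ, S.indicator (1 : G → ℝ≥0∞) (z + i γ) ∂m :=
        (lintegral_tsum fun γ => ((measurable_one.indicator hS).comp
          (measurable_add_const _)).aemeasurable).symm
    _ ≤ ∫⁻ _, N ∂m := lintegral_mono fun z => hN z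
    _ < ∞ := by
        rw [lintegral_const]
        exact ENNReal.mul_lt_top hNt.lt_top (measure_lt_top m _)

/-- If a periodization of an absolutely continuous finite measure is invariant under hyperbolic
automorphisms, the measure is dominated by a multiple of Haar measure. -/
theorem exists_le_smul_of_periodization_invariant (dx : Measure G) [dx.IsAddHaarMeasure]
    (m : Measure G) [IsFiniteMeasure m] (hm : m ≪ dx) (i : Λ →+ G)
    (hN : ∀ Q : Set G, IsCompact Q → ∃ N : ℝ≥0∞, N ≠ ∞ ∧ HasMultiplicityLE i Q N)
    (Θ : ℕ → G ≃ₜ+ G) (θ : ℕ → Λ ≃ Λ) (hθ : ∀ n γ, Θ n (i γ) = i (θ n γ))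
    (hinv : ∀ n, (periodization i m).map (Θ n) = periodization i m)
    (hdec : ∀ x : G, ∃ a b : G, x = a + b ∧ Tendsto (fun n => Θ n a) atTop (𝓝 0) ∧
      Tendsto (fun n => (Θ n).symm b) atTop (𝓝 0)) :
    ∃ c : ℝ≥0, m ≤ c • dx := by
  have hθ' : ∀ n γ, (Θ n).symm (i γ) = i ((θ n).symm γ) := by
    intro n γ
    rw [← (Θ n).injective.eq_iff, hθ]
    simp
  have hinv' : ∀ n, (periodization i m).map (Θ n).symm = periodization i m := by
    intro n
    conv_lhs => rw [← hinv n]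
    have h1 : Measurable (Θ n).symm := (Θ n).symm.continuous.measurable
    have h2 : Measurable (Θ n) := (Θ n).continuous.measurable
    rw [Measure.map_map h1 h2]
    have : ⇑(Θ n).symm ∘ ⇑(Θ n) = id := by ext; simp
    rw [this, Measure.map_id]
  -- Every vector is a stable one plus an unstable one; the unstable part is handled by the inverse
  -- automorphisms.
  have htrans : ∀ x, (periodization i m).map (· + x) = periodization i m := by
    intro x
    obtain ⟨a, b, rfl, ha, hb⟩ := hdec x
    have e : (· + (a + b)) = (· + b) ∘ (· + a) := by ext z; simp [add_assoc]
    rw [e, ← Measure.map_map (measurable_add_const b) (measurable_add_const a),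
      periodization_map_add_right_eq dx m hm i hN Θ θ hθ hinv ha,
      periodization_map_add_right_eq dx m hm i hN (fun n => (Θ n).symm) (fun n => (θ n).symm)
        hθ' hinv' hb]
  have : (periodization i m).IsAddLeftInvariant := ⟨fun x => by
    simpa only [add_comm x] using htrans x⟩
  have : IsFiniteMeasureOnCompacts (periodization i m) := ⟨fun Q hQ => by
    obtain ⟨N, hNt, hNQ⟩ := hN Q hQ
    exact periodization_lt_top_of_hasMultiplicityLE i m hQ.measurableSet hNt hNQ⟩
  exact ⟨_, (le_periodization i m).trans_eq
    (Measure.isAddLeftInvariant_eq_smul (periodization i m) dx)⟩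

end Translation

/-! ### Shannon entropy of finitely valued variables -/

section Entropy

variable {Ω E : Type*} [MeasurableSpace Ω] (P : Measure Ω)

lemma measureReal_fiber_eq_zero {X : Ω → E} {F : Finset E} (hF : ∀ᵐ ω ∂P, X ω ∈ F) {x : E}
    (hx : x ∉ F) : P.real (X ⁻¹' {x}) = 0 := by
  have h : P (X ⁻¹' {x}) = 0 := by
    refine measure_mono_null ?_ hF
    rintro ω rfl
    exact hx
  simp [Measure.real, h]

lemma shannonEntropy_eq_sum {X : Ω → E} {F : Finset E} (hF : ∀ᵐ ω ∂P, X ω ∈ F) :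
    shannonEntropy P X = ∑ x ∈ F, Real.negMulLog (P.real (X ⁻¹' {x})) :=
  tsum_eq_sum fun x hx => by rw [measureReal_fiber_eq_zero P hF hx, Real.negMulLog_zero]

variable [IsProbabilityMeasure P]

lemma measureReal_preimage_finset {X : Ω → E} (hX : ∀ x, MeasurableSet (X ⁻¹' {x}))
    (T : Finset E) : P.real (X ⁻¹' T) = ∑ x ∈ T, P.real (X ⁻¹' {x}) := by
  rw [← measureReal_biUnion_finset]
  · congr 1
    ext ω
    simp
  · intro x _ y _ hxy
    exact Disjoint.preimage _ (by simpa using hxy)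
  · exact fun x _ => hX x

lemma sum_measureReal_fiber {X : Ω → E} (hX : ∀ x, MeasurableSet (X ⁻¹' {x})) {F : Finset E}
    (hF : ∀ᵐ ω ∂P, X ω ∈ F) : ∑ x ∈ F, P.real (X ⁻¹' {x}) = 1 := by
  rw [← measureReal_preimage_finset P hX]
  have : P (X ⁻¹' F) = 1 := (prob_compl_eq_zero_iff₀ (by
    have : X ⁻¹' F = ⋃ x ∈ F, X ⁻¹' {x} := by ext; simp
    rw [this]
    exact (F.measurableSet_biUnion fun x _ => hX x).nullMeasurableSet)).1 hF
  simp [Measure.real, this]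

/-- Gibbs' inequality. -/
lemma shannonEntropy_le_cross {X : Ω → E} (hX : ∀ x, MeasurableSet (X ⁻¹' {x})) {F : Finset E}
    (hF : ∀ᵐ ω ∂P, X ω ∈ F) (q : E → ℝ) (hq : ∀ x ∈ F, 0 < q x) (hsum : ∑ x ∈ F, q x ≤ 1) :
    shannonEntropy P X ≤ ∑ x ∈ F, P.real (X ⁻¹' {x}) * (-Real.log (q x)) := by
  rw [shannonEntropy_eq_sum P hF]
  -- This is `log t ≤ t - 1` at `t = q / p`; the corrections `q - p` sum to at most 0.
  have key : ∀ x ∈ F, Real.negMulLog (P.real (X ⁻¹' {x})) ≤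
      P.real (X ⁻¹' {x}) * (-Real.log (q x)) + (q x - P.real (X ⁻¹' {x})) := by
    intro x hx
    rcases eq_or_lt_of_le (measureReal_nonneg (μ := P) (s := X ⁻¹' {x})) with h0 | hp
    · rw [← h0]
      simpa using (hq x hx).le
    · set p := P.real (X ⁻¹' {x})
      have hl := Real.log_le_sub_one_of_pos (div_pos (hq x hx) hp)
      rw [Real.log_div (hq x hx).ne' hp.ne'] at hl
      have h2 := mul_le_mul_of_nonneg_left hl hp.le
      have h3 : p * (q x / p - 1) = q x - p := by field_simp
      rw [Real.negMulLog]
      linarith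
  refine (Finset.sum_le_sum key).trans ?_
  rw [Finset.sum_add_distrib, Finset.sum_sub_distrib, sum_measureReal_fiber P hX hF]
  linarith

/-- Entropy of a variable with at most `#F` values, `#T` of which carry the mass `p`. -/
lemma shannonEntropy_le_of_subset {X : Ω → E} (hX : ∀ x, MeasurableSet (X ⁻¹' {x}))
    {F T : Finset E} (hF : ∀ᵐ ω ∂P, X ω ∈ F) (hTF : T ⊆ F) :
    shannonEntropy P X ≤ Real.log 2 + P.real (X ⁻¹' T) * Real.log T.card +
      (1 - P.real (X ⁻¹' T)) * Real.log F.card := by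
  classical
  rcases T.eq_empty_or_nonempty with rfl | hT
  · have hne : F.Nonempty := by
      by_contra h
      rw [Finset.not_nonempty_iff_eq_empty] at h
      have := sum_measureReal_fiber P hX hF
      simp [h] at this
    have hc : (0 : ℝ) < F.card := by exact_mod_cast hne.card_pos
    have := shannonEntropy_le_cross P hX hF (fun _ => (F.card : ℝ)⁻¹) (fun _ _ => by positivity)
      (by simp [hc.ne'])
    rw [← Finset.sum_mul, sum_measureReal_fiber P hX hF, Real.log_inv] at this
    simp only [Finset.coe_empty, Set.preimage_empty, measureReal_empty]
    have := Real.log_pos (show (1 : ℝ) < 2 by norm_num)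
    linarith
  have hTc : (0 : ℝ) < T.card := by exact_mod_cast hT.card_pos
  have hFc : (0 : ℝ) < F.card := by exact_mod_cast (hT.mono hTF).card_pos
  -- Half the mass is spread evenly over `T`, and the rest of `F` gets the weights of half a uniform
  -- law on `F`. The halves cost the `log 2`.
  set q : E → ℝ := fun x => if x ∈ T then (2 * T.card : ℝ)⁻¹ else (2 * F.card : ℝ)⁻¹ with hq
  have hsplit : ∀ g : E → ℝ, ∑ x ∈ F, g x = ∑ x ∈ T, g x + ∑ x ∈ F \ T, g x := fun g => by
    rw [add_comm, Finset.sum_sdiff hTF]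
  have hqT : ∀ x ∈ T, q x = (2 * T.card : ℝ)⁻¹ := fun x hx => by simp [hq, hx]
  have hqF : ∀ x ∈ F \ T, q x = (2 * F.card : ℝ)⁻¹ := fun x hx => by
    simp [hq, (Finset.mem_sdiff.1 hx).2]
  have hs : ∑ x ∈ F, q x ≤ 1 := by
    rw [hsplit, Finset.sum_congr rfl hqT, Finset.sum_congr rfl hqF, Finset.sum_const,
      Finset.sum_const, nsmul_eq_mul, nsmul_eq_mul]
    have h1 : ((F \ T).card : ℝ) ≤ F.card := by
      exact_mod_cast Finset.card_le_card Finset.sdiff_subset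
    have h2 : (T.card : ℝ) * (2 * T.card : ℝ)⁻¹ = 1 / 2 := by field_simp
    have h3 : ((F \ T).card : ℝ) * (2 * F.card : ℝ)⁻¹ ≤ F.card * (2 * F.card : ℝ)⁻¹ := by gcongr
    have h4 : (F.card : ℝ) * (2 * F.card : ℝ)⁻¹ = 1 / 2 := by field_simp
    linarith
  refine (shannonEntropy_le_cross P hX hF q (fun x _ => ?_) hs).trans (le_of_eq ?_)
  · simp only [hq]
    split_ifs <;> positivity
  have hsum := sum_measureReal_fiber P hX hF
  rw [hsplit] at hsum ⊢
  rw [measureReal_preimage_finset P hX,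
    Finset.sum_congr rfl fun x hx => by rw [hqT x hx, Real.log_inv, Real.log_mul two_ne_zero hTc.ne'],
    Finset.sum_congr (s₁ := F \ T) rfl fun x hx => by
      rw [hqF x hx, Real.log_inv, Real.log_mul two_ne_zero hFc.ne'],
    ← Finset.sum_mul, ← Finset.sum_mul]
  have h : ∑ x ∈ F \ T, P.real (X ⁻¹' {x}) = 1 - ∑ x ∈ T, P.real (X ⁻¹' {x}) := by linarith
  rw [h]
  ring

/-- On a fibre of `f` with total mass `s`, each atom has `p ≤ s`, hence `-p log s ≤ -p log p`; sum
over the fibre. -/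
lemma shannonEntropy_comp_le {E' : Type*} {X : Ω → E} (hX : ∀ x, MeasurableSet (X ⁻¹' {x}))
    {F : Finset E} (hF : ∀ᵐ ω ∂P, X ω ∈ F) (f : E → E') :
    shannonEntropy P (f ∘ X) ≤ shannonEntropy P X := by
  classical
  have hF' : ∀ᵐ ω ∂P, (f ∘ X) ω ∈ F.image f := by
    filter_upwards [hF] with ω h using Finset.mem_image_of_mem f h
  rw [shannonEntropy_eq_sum P hF, shannonEntropy_eq_sum P hF',
    ← Finset.sum_fiberwise_of_maps_to (t := F.image f) (g := f)
      fun x hx => Finset.mem_image_of_mem f hx]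
  refine Finset.sum_le_sum fun y hy => ?_
  have e : P.real ((f ∘ X) ⁻¹' {y}) = ∑ x ∈ F with f x = y, P.real (X ⁻¹' {x}) := by
    rw [← measureReal_preimage_finset P hX]
    refine measureReal_congr ?_
    filter_upwards [hF] with ω h
    apply propext
    change f (X ω) = y ↔ X ω ∈ ((F.filter fun x => f x = y : Finset E) : Set E)
    simp [h]
  rw [e]
  set s := ∑ x ∈ F with f x = y, P.real (X ⁻¹' {x}) with hs
  rw [Real.negMulLog, neg_mul, hs, Finset.sum_mul, ← Finset.sum_neg_distrib, ← hs]
  refine Finset.sum_le_sum fun x hx => ?_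
  have hnn := measureReal_nonneg (μ := P) (s := X ⁻¹' {x})
  rcases eq_or_lt_of_le hnn with h0 | hp
  · rw [← h0]
    simp
  · rw [Real.negMulLog, neg_mul, neg_le_neg_iff]
    gcongr
    exact Finset.single_le_sum (f := fun x => P.real (X ⁻¹' {x}))
      (fun _ _ => measureReal_nonneg) hx

omit [IsProbabilityMeasure P] in
lemma shannonEntropy_comp_injective {E' : Type*} (X : Ω → E) {f : E → E'}
    (hf : f.Injective) : shannonEntropy P (f ∘ X) = shannonEntropy P X := by
  rw [shannonEntropy, shannonEntropy, ← hf.tsum_eq]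
  · refine tsum_congr fun x => ?_
    rw [Set.preimage_comp]
    congr 3
    ext z
    simp [hf.eq_iff]
  · intro y hy
    by_contra h
    apply hy
    have : (f ∘ X) ⁻¹' {y} = ∅ := by
      ext ω
      simp only [Set.mem_preimage, Function.comp_apply, Set.mem_singleton_iff,
        Set.mem_empty_iff_false, iff_false]
      rintro rfl
      exact h ⟨_, rfl⟩
    simp [this]

lemma shannonEntropy_prodMk {E' : Type*} {X : Ω → E} {Y : Ω → E'}
    (hX : ∀ x, MeasurableSet (X ⁻¹' {x})) (hY : ∀ y, MeasurableSet (Y ⁻¹' {y}))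
    {F : Finset E} {F' : Finset E'} (hF : ∀ᵐ ω ∂P, X ω ∈ F) (hF' : ∀ᵐ ω ∂P, Y ω ∈ F')
    (hind : ∀ x y, P (X ⁻¹' {x} ∩ Y ⁻¹' {y}) = P (X ⁻¹' {x}) * P (Y ⁻¹' {y})) :
    shannonEntropy P (fun ω => (X ω, Y ω)) = shannonEntropy P X + shannonEntropy P Y := by
  have hFF : ∀ᵐ ω ∂P, (X ω, Y ω) ∈ F ×ˢ F' := by
    filter_upwards [hF, hF'] with ω h h' using Finset.mk_mem_product h h'
  rw [shannonEntropy_eq_sum P hF, shannonEntropy_eq_sum P hF', shannonEntropy_eq_sum P hFF,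
    Finset.sum_product]
  have e : ∀ x y, P.real ((fun ω => (X ω, Y ω)) ⁻¹' {(x, y)}) =
      P.real (X ⁻¹' {x}) * P.real (Y ⁻¹' {y}) := by
    intro x y
    have : (fun ω => (X ω, Y ω)) ⁻¹' {(x, y)} = X ⁻¹' {x} ∩ Y ⁻¹' {y} := by
      ext; simp
    rw [this, Measure.real, hind, ENNReal.toReal_mul]
    rfl
  simp_rw [e, Real.negMulLog_mul, Finset.sum_add_distrib, ← Finset.mul_sum, ← Finset.sum_mul]
  rw [sum_measureReal_fiber P hX hF, sum_measureReal_fiber P hY hF', one_mul]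
  simp_rw [one_mul]

end Entropy

/-! ### Maximal entropy implies absolute continuity -/

section AbsolutelyContinuous

open Pointwise

variable {A B Λ : Type*}
  [AddCommGroup A] [TopologicalSpace A] [IsTopologicalAddGroup A] [LocallyCompactSpace A]
  [T2Space A] [SecondCountableTopology A] [MeasurableSpace A] [BorelSpace A]
  [AddCommGroup B] [TopologicalSpace B] [AddCommGroup Λ]

omit [LocallyCompactSpace A] [T2Space A] [SecondCountableTopology A] [TopologicalSpace B] in
/-- Points of a discrete group whose `A`-components have their `Θ O`-translates inside `R` and
whose `B`-components are bounded are at most as many as a volume comparison predicts. -/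
lemma card_mul_le_of_hasMultiplicityLE (dx : Measure A) [dx.IsAddHaarMeasure] (i : Λ →+ A × B)
    (Θ : A ≃ₜ+ A) (θ : Λ ≃ Λ) (hθ : ∀ γ, Θ (i γ).1 = (i (θ γ)).1) {O : Set A} {W : Set B}
    (hO : MeasurableSet O) {N : ℝ≥0∞} (hN : HasMultiplicityLE i ((-O) ×ˢ W) N) {T : Finset Λ}
    (hTW : ∀ γ ∈ T, (i (θ.symm γ)).2 ∈ W) {R : Set A} (hR : MeasurableSet R)
    (hTR : ∀ γ ∈ T, ∀ o ∈ O, (i γ).1 + Θ o ∈ R) :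
    T.card * dx (Θ '' O) ≤ N * dx R := by
  classical
  have hΘO : MeasurableSet (Θ '' O) := Θ.toHomeomorph.toMeasurableEquiv.measurableSet_image.2 hO
  have hm : ∀ γ, MeasurableSet ((· + -(i γ).1) ⁻¹' (Θ '' O)) := fun γ =>
    measurable_add_const _ hΘO
  -- If `x` lies in the tile `γ + Θ O`, pulling back by `Θ` puts `-Θ⁻¹ x + θ⁻¹ γ` in `-O`, with
  -- second component in `W`. So the number of tiles over `x` is a multiplicity of `(-O) ×ˢ W` at
  -- `(-Θ⁻¹ x, 0)`.
  have hpt : ∀ x, ∑ γ ∈ T, ((· + -(i γ).1) ⁻¹' (Θ '' O)).indicator (1 : A → ℝ≥0∞) x ≤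
      N * R.indicator (1 : A → ℝ≥0∞) x := by
    intro x
    by_cases hx : x ∈ R
    · rw [Set.indicator_of_mem hx, Pi.one_apply, mul_one]
      refine le_trans ?_ (hN (-Θ.symm x, 0))
      rw [← θ.symm.tsum_eq]
      refine le_trans (Finset.sum_le_sum fun γ hγ => ?_) (ENNReal.sum_le_tsum T)
      by_cases h : x ∈ (· + -(i γ).1) ⁻¹' (Θ '' O)
      swap
      · rw [Set.indicator_of_notMem h]
        exact zero_le
      rw [Set.indicator_of_mem h]
      obtain ⟨o, ho, hox⟩ := h
      have hmem : (-Θ.symm x, (0 : B)) + i (θ.symm γ) ∈ (-O) ×ˢ W := by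
        refine ⟨?_, by simpa using hTW γ hγ⟩
        have e : (i (θ.symm γ)).1 = Θ.symm (i γ).1 := by
          rw [← Θ.injective.eq_iff, hθ]
          simp
        have e2 : x = Θ o + (i γ).1 := by
          rw [hox]
          simp
        have : -Θ.symm x + (i (θ.symm γ)).1 = -o := by
          rw [e, e2]
          simp
        simpa [this] using ho
      rw [Set.indicator_of_mem hmem]
      rfl
    · rw [Set.indicator_of_notMem hx, mul_zero]
      refine le_of_eq (Finset.sum_eq_zero fun γ hγ => Set.indicator_of_notMem ?_ _)
      rintro ⟨o, ho, hox⟩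
      apply hx
      have := hTR γ hγ o ho
      rw [hox] at this
      simpa using this
  calc (T.card : ℝ≥0∞) * dx (Θ '' O)
      = ∑ γ ∈ T, ∫⁻ x, ((· + -(i γ).1) ⁻¹' (Θ '' O)).indicator (1 : A → ℝ≥0∞) x ∂dx := by
        simp_rw [lintegral_indicator_one (hm _), measure_preimage_add_right]
        rw [Finset.sum_const, nsmul_eq_mul]
    _ = ∫⁻ x, ∑ γ ∈ T, ((· + -(i γ).1) ⁻¹' (Θ '' O)).indicator (1 : A → ℝ≥0∞) x ∂dx :=
        (lintegral_finsetSum _ fun γ _ => measurable_one.indicator (hm γ)).symm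
    _ ≤ ∫⁻ x, N * R.indicator (1 : A → ℝ≥0∞) x ∂dx := lintegral_mono hpt
    _ = N * dx R := by
        rw [lintegral_const_mul _ (measurable_one.indicator hR), lintegral_indicator_one hR]

lemma exists_pos_log_mul_eq {C L : ℝ} (hC : 0 < C) : ∃ ε : ℝ, 0 < ε ∧ Real.log (C * ε) = -L :=
  ⟨Real.exp (-L) / C, by positivity, by rw [mul_div_cancel₀ _ hC.ne', Real.log_exp]⟩

/-- Random variables `X` approximated at scale `Θ n` by points `Y n` of a discrete group, with the
entropy of `Y n` as large as a volume comparison allows, have an absolutely continuous law. -/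
theorem map_absolutelyContinuous_of_entropy (dx : Measure A) [dx.IsAddHaarMeasure]
    (i : Λ →+ A × B)
    (hN : ∀ Q : Set (A × B), IsCompact Q → ∃ N : ℝ≥0∞, N ≠ ∞ ∧ HasMultiplicityLE i Q N)
    (Θ : ℕ → A ≃ₜ+ A) (θ : ℕ → Λ ≃ Λ) (hθ : ∀ n γ, Θ n (i γ).1 = (i (θ n γ)).1)
    (hcontr : ∀ Q : Set A, IsCompact Q → ∀ V ∈ 𝓝 (0 : A), ∀ᶠ n in atTop, Θ n '' Q ⊆ V)
    {M : ℝ} (hM : 0 < M)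
    (hscale : ∀ n S, dx S ≤ ENNReal.ofReal (M ^ n) * dx (Θ n '' S))
    {Ω : Type*} [MeasurableSpace Ω] (P : Measure Ω) [IsProbabilityMeasure P]
    (X : Ω → A) (hX : AEMeasurable X P) (Y : ℕ → Ω → Λ)
    (hY : ∀ n x, MeasurableSet (Y n ⁻¹' {x})) (hfin : ∀ n, ∃ F : Finset Λ, ∀ᵐ ω ∂P, Y n ω ∈ F)
    {Q : Set A} (hQ : IsCompact Q) {W : Set B} (hW : IsCompact W)
    (hXY : ∀ n, ∀ᵐ ω ∂P, ∃ q ∈ Q, X ω = (i (Y n ω)).1 + Θ n q)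
    (hYQ : ∀ n, ∀ᵐ ω ∂P, (i (Y n ω)).1 ∈ Q)
    (hYW : ∀ n, ∀ᵐ ω ∂P, (i ((θ n).symm (Y n ω))).2 ∈ W)
    (hH : ∀ n : ℕ, n * Real.log M ≤ shannonEntropy P (Y n)) :
    P.map X ≪ dx := by
  classical
  refine Measure.AbsolutelyContinuous.mk fun E hE hE0 => ?_
  by_contra hne
  have hPX : IsProbabilityMeasure (P.map X) := Measure.isProbabilityMeasure_map hX
  -- A compact null set that is still charged has open neighbourhoods of arbitrarily small volume.
  obtain ⟨E', hE'E, hE'c, hE'pos⟩ := hE.exists_lt_isCompact (pos_iff_ne_zero.2 hne)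
  have hE'0 : dx E' = 0 := measure_mono_null hE'E hE0
  set δ := (P.map X).real E' with hδ
  have hδ0 : 0 < δ := ENNReal.toReal_pos hE'pos.ne' (measure_ne_top _ _)
  obtain ⟨O, hOc, hO0⟩ := exists_compact_mem_nhds (0 : A)
  have hOm := hOc.measurableSet
  obtain ⟨N, hNt, hN⟩ := hN _ (hOc.neg.prod hW)
  have hdO : 0 < dx O := Measure.measure_pos_of_mem_nhds dx hO0
  have hdOt : dx O ≠ ∞ := hOc.measure_lt_top.ne
  have hdOr : 0 < dx.real O := ENNReal.toReal_pos hdO.ne' hdOt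
  -- the counting bound in real form
  have hcount : ∀ (n : ℕ) (T : Finset Λ) (R : Set A), MeasurableSet R → dx R ≠ ∞ →
      (∀ γ ∈ T, (i ((θ n).symm γ)).2 ∈ W) → (∀ γ ∈ T, ∀ o ∈ O, (i γ).1 + Θ n o ∈ R) →
      (T.card : ℝ) ≤ N.toReal * dx.real R / dx.real O * M ^ n := by
    intro n T R hR hRt hTW hTR
    have h1 := card_mul_le_of_hasMultiplicityLE dx i (Θ n) (θ n) (hθ n) hOm hN hTW hR hTR
    have h2 : (T.card : ℝ≥0∞) * dx O ≤ ENNReal.ofReal (M ^ n) * (N * dx R) :=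
      calc (T.card : ℝ≥0∞) * dx O ≤ T.card * (ENNReal.ofReal (M ^ n) * dx (Θ n '' O)) := by
            gcongr
            exact hscale n O
        _ = ENNReal.ofReal (M ^ n) * (T.card * dx (Θ n '' O)) := by ring
        _ ≤ _ := by gcongr
    have h3 := ENNReal.toReal_mono (ENNReal.mul_ne_top ENNReal.ofReal_ne_top
      (ENNReal.mul_ne_top hNt hRt)) h2
    simp only [ENNReal.toReal_mul, ENNReal.toReal_natCast,
      ENNReal.toReal_ofReal (pow_pos hM n).le] at h3
    rw [div_mul_eq_mul_div, le_div_iff₀ hdOr]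
    calc (T.card : ℝ) * dx.real O ≤ M ^ n * (N.toReal * dx.real R) := h3
      _ = _ := by ring
  have hQO : IsCompact (Q + O) := hQ.add hOc
  -- The maxima with 1 make `log C₁ ≥ 0` and `C₂ > 0`.
  set C₁ := max (N.toReal * dx.real (Q + O) / dx.real O) 1 with hC₁
  have hC₁1 : 1 ≤ C₁ := le_max_right _ _
  set C₂ := max N.toReal 1 / dx.real O with hC₂
  have hC₂0 : 0 < C₂ := by positivity
  -- A mass at least `δ` sits on few values, each saving the amount `L` below; dividing by `δ` makes
  -- the total saving exceed `log 2 + log C₁`.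
  obtain ⟨ε, hε, hlogε⟩ := exists_pos_log_mul_eq (L := (Real.log 2 + Real.log C₁ + 1) / δ) hC₂0
  obtain ⟨U, hEU, hUo, hUε⟩ := hE'c.exists_isOpen_lt_of_lt (μ := dx) (ENNReal.ofReal ε)
    (by rw [hE'0]; simpa using hε)
  obtain ⟨V, hV, hEV⟩ := compact_open_separated_add_right hE'c hUo hEU
  -- For this `n`, replacing `Θ n q` by `Θ n o` moves a point by an element of `V`: a tile with a
  -- point `γ + Θ n q` in `E'` stays inside `U`.
  obtain ⟨n, hn1, hn2⟩ := ((hcontr (O - Q)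
    (by simpa [sub_eq_add_neg] using hOc.add hQ.neg) V hV).and (hcontr O hOc O hO0)).exists
  obtain ⟨F₀, hF₀⟩ := hfin n
  set F := F₀.filter fun γ => (i γ).1 ∈ Q ∧ (i ((θ n).symm γ)).2 ∈ W with hF
  have hYF : ∀ᵐ ω ∂P, Y n ω ∈ F := by
    filter_upwards [hF₀, hYQ n, hYW n] with ω h1 h2 h3
    exact Finset.mem_filter.2 ⟨h1, h2, h3⟩
  set T := F.filter fun γ => ∃ q ∈ Q, (i γ).1 + Θ n q ∈ E' with hT
  have hTF : T ⊆ F := Finset.filter_subset _ _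
  have hFcard : (F.card : ℝ) ≤ C₁ * M ^ n := by
    refine (hcount n F (Q + O) hQO.measurableSet hQO.measure_lt_top.ne (fun γ hγ => ?_)
      fun γ hγ o ho => ?_).trans ?_
    · exact (Finset.mem_filter.1 hγ).2.2
    · exact Set.add_mem_add (Finset.mem_filter.1 hγ).2.1 (hn2 ⟨o, ho, rfl⟩)
    · gcongr
      exact le_max_left _ _
  have hTcard : (T.card : ℝ) ≤ C₂ * ε * M ^ n := by
    refine (hcount n T U hUo.measurableSet (hUε.trans ENNReal.ofReal_lt_top).ne (fun γ hγ => ?_)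
      fun γ hγ o ho => ?_).trans ?_
    · exact (Finset.mem_filter.1 (hTF hγ)).2.2
    · obtain ⟨q, hq, hqE⟩ := (Finset.mem_filter.1 hγ).2
      have h := hEV (Set.add_mem_add hqE (hn1 ⟨o - q, Set.sub_mem_sub ho hq, rfl⟩))
      simpa using h
    · have : dx.real U ≤ ε := ENNReal.toReal_le_of_le_ofReal hε.le hUε.le
      calc N.toReal * dx.real U / dx.real O * M ^ n
          ≤ max N.toReal 1 * ε / dx.real O * M ^ n := by
            gcongr
            exact le_max_left _ _
        _ = _ := by rw [hC₂]; ring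
  set p := P.real (Y n ⁻¹' T) with hp
  have hpδ : δ ≤ p := by
    rw [hδ, hp, Measure.real, Measure.real, Measure.map_apply_of_aemeasurable hX hE'c.measurableSet]
    refine ENNReal.toReal_mono (measure_ne_top _ _) (measure_mono_ae ?_)
    filter_upwards [hXY n, hYF] with ω h1 h2 h3
    obtain ⟨q, hq, hqX⟩ := h1
    refine Finset.mem_coe.2 (Finset.mem_filter.2 ⟨h2, q, hq, ?_⟩)
    rw [← hqX]
    exact h3
  have hp1 : p ≤ 1 := measureReal_le_one
  have hTne : T.Nonempty := by
    by_contra h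
    rw [Finset.not_nonempty_iff_eq_empty] at h
    simp only [h, Finset.coe_empty, Set.preimage_empty, measureReal_empty] at hp
    linarith
  have hTpos : (0 : ℝ) < T.card := by exact_mod_cast hTne.card_pos
  have hFpos : (0 : ℝ) < F.card := by exact_mod_cast (hTne.mono hTF).card_pos
  have hlogT : Real.log T.card ≤ -((Real.log 2 + Real.log C₁ + 1) / δ) + n * Real.log M := by
    rw [← hlogε, ← Real.log_pow, ← Real.log_mul (by positivity) (by positivity)]
    exact Real.log_le_log hTpos hTcard
  have hlogF : Real.log F.card ≤ Real.log C₁ + n * Real.log M := by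
    rw [← Real.log_pow, ← Real.log_mul (by positivity) (by positivity)]
    exact Real.log_le_log hFpos hFcard
  have hent := (hH n).trans (shannonEntropy_le_of_subset P (hY n) hYF hTF)
  have hC₁0 : 0 ≤ Real.log C₁ := Real.log_nonneg hC₁1
  have hl2 : 0 < Real.log 2 := Real.log_pos (by norm_num)
  have h1 := mul_le_mul_of_nonneg_left hlogT (hδ0.le.trans hpδ)
  have h2 := mul_le_mul_of_nonneg_left hlogF (sub_nonneg.2 hp1)
  have h3 : Real.log 2 + Real.log C₁ + 1 ≤ p * ((Real.log 2 + Real.log C₁ + 1) / δ) := by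
    rw [mul_div_assoc', le_div_iff₀ hδ0, mul_comm]
    gcongr
  have h4 : 0 ≤ p * Real.log C₁ := mul_nonneg (hδ0.le.trans hpδ) hC₁0
  -- The terms `n log M` cancel, and what remains reads `0 ≤ -1`.
  nlinarith [h1, h2, h3, h4, hent]

end AbsolutelyContinuous

/-! ### Finite places: weak approximation and local compactness -/

section FinitePlaces

open HeightOneSpectrum

variable {K : Type*} [Field K] [NumberField K]

lemma norm_algebraMap_adicCompletion (v : HeightOneSpectrum (𝓞 K)) (x : K) :
    ‖algebraMap K (v.adicCompletion K) x‖ = adicAbv K v x :=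
  FinitePlace.norm_embedding v x

lemma adicAbv_le_iff (v : HeightOneSpectrum (𝓞 K)) (x y : K) :
    adicAbv K v x ≤ adicAbv K v y ↔ v.valuation K x ≤ v.valuation K y := by
  rw [adicAbv_def, adicAbv_def, NNReal.coe_le_coe,
    (WithZeroMulInt.toNNReal_strictMono (one_lt_absNorm_nnreal v)).le_iff_le]

lemma mem_range_of_adicAbv_le_one {x : K} (h : ∀ v : HeightOneSpectrum (𝓞 K), adicAbv K v x ≤ 1) :
    ∃ r : 𝓞 K, algebraMap (𝓞 K) K r = x := by
  refine HeightOneSpectrum.mem_integers_of_valuation_le_one K x fun v => ?_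
  simpa using (adicAbv_le_iff v x 1).1 (by simpa using h v)

lemma exists_pow_lt_adicAbv (v : HeightOneSpectrum (𝓞 K)) {ε : ℝ} (hε : 0 < ε) :
    ∃ e : ℕ, ∀ r ∈ v.asIdeal ^ e, adicAbv K v (algebraMap (𝓞 K) K r) < ε := by
  have h1 : 1 < (Ideal.absNorm v.asIdeal : ℝ≥0) := one_lt_absNorm_nnreal v
  obtain ⟨e, he⟩ := exists_pow_lt_of_lt_one hε
    (show ((Ideal.absNorm v.asIdeal : ℝ)⁻¹) < 1 from inv_lt_one_of_one_lt₀ (by exact_mod_cast h1))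
  refine ⟨e, fun r hr => lt_of_le_of_lt ?_ he⟩
  rw [← intValuation_le_pow_iff_mem] at hr
  rw [adicAbv_def, valuation_of_algebraMap]
  have h2 := (WithZeroMulInt.toNNReal_strictMono h1).monotone hr
  refine (NNReal.coe_le_coe.2 h2).trans (le_of_eq ?_)
  rw [WithZeroMulInt.toNNReal_neg_apply _ WithZero.exp_ne_zero]
  change (((Ideal.absNorm v.asIdeal : ℝ≥0) ^ (-(e : ℤ)) : ℝ≥0) : ℝ) = _
  simp

instance (v : HeightOneSpectrum (𝓞 K)) : IsUltrametricDist (v.adicCompletion K) := by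
  refine IsUltrametricDist.isUltrametricDist_of_isNonarchimedean_norm fun x y => ?_
  have h := (WithZeroMulInt.toNNReal_strictMono (one_lt_absNorm_nnreal v)).monotone
  rw [FinitePlace.norm_def, FinitePlace.norm_def, FinitePlace.norm_def, ← NNReal.coe_max,
    NNReal.coe_le_coe, ← h.map_max]
  exact h (Valuation.map_add _ x y)

lemma exists_ne_zero_adicAbv_lt (v : HeightOneSpectrum (𝓞 K)) {ε : ℝ} (hε : 0 < ε) :
    ∃ c : 𝓞 K, c ≠ 0 ∧ adicAbv K v (algebraMap (𝓞 K) K c) < ε := by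
  obtain ⟨e, he⟩ := exists_pow_lt_adicAbv v hε
  obtain ⟨c, hc, hc0⟩ := Submodule.exists_mem_ne_zero_of_ne_bot (pow_ne_zero e v.ne_bot)
  exact ⟨c, hc0, he c hc⟩

/-- `K` is dense in the completion, a close enough approximant is `v`-integral by the ultrametric
inequality, and `v`-integral elements of `K` are approximated by global integers. -/
lemma exists_integer_norm_sub_lt (v : HeightOneSpectrum (𝓞 K)) {y : v.adicCompletion K}
    (hy : ‖y‖ ≤ 1) {ε : ℝ} (hε : 0 < ε) :
    ∃ r : 𝓞 K, ‖algebraMap K (v.adicCompletion K) (algebraMap (𝓞 K) K r) - y‖ < ε := by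
  obtain ⟨x, hx⟩ := (v.denseRange_algebraMap K).exists_dist_lt y (lt_min hε one_pos)
  rw [dist_comm, dist_eq_norm] at hx
  have hx1 : ‖algebraMap K (v.adicCompletion K) x‖ ≤ 1 := by
    have := IsUltrametricDist.norm_add_le_max (algebraMap K (v.adicCompletion K) x - y) y
    rw [sub_add_cancel] at this
    exact this.trans (max_le (hx.le.trans (min_le_right _ _)) hy)
  rw [norm_algebraMap_adicCompletion] at hx1
  obtain ⟨c, hc0, hc⟩ := exists_ne_zero_adicAbv_lt v hε
  have hc0' : v.valuation K (algebraMap (𝓞 K) K c) ≠ 0 := by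
    rw [Valuation.ne_zero_iff]
    simpa using hc0
  obtain ⟨r, hr⟩ := v.exists_valuation_sub_lt_of_integer (x := x)
    (by simpa using (adicAbv_le_iff v x 1).1 (by simpa using hx1)) (Units.mk0 _ hc0')
  have hr' : adicAbv K v (algebraMap (𝓞 K) K r - x) < ε :=
    ((adicAbv_le_iff v _ _).2 (by simpa using hr.le)).trans_lt hc
  refine ⟨r, ?_⟩
  have := IsUltrametricDist.norm_add_le_max
    (algebraMap K (v.adicCompletion K) (algebraMap (𝓞 K) K r - x))
    (algebraMap K (v.adicCompletion K) x - y)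
  rw [norm_algebraMap_adicCompletion, map_sub, sub_add_sub_cancel] at this
  exact this.trans_lt (max_lt hr' (hx.trans_le (min_le_left _ _)))

/-- Weak approximation by integers at finitely many finite places. -/
lemma exists_integer_forall_norm_sub_lt (s : Finset (HeightOneSpectrum (𝓞 K)))
    (y : ∀ v : HeightOneSpectrum (𝓞 K), v.adicCompletion K) (hy : ∀ v ∈ s, ‖y v‖ ≤ 1)
    {ε : ℝ} (hε : 0 < ε) :
    ∃ r : 𝓞 K, ∀ v ∈ s, ‖algebraMap K (v.adicCompletion K) (algebraMap (𝓞 K) K r) - y v‖ < ε := by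
  choose e he using fun v => exists_pow_lt_adicAbv (K := K) v hε
  choose! q hq using fun v (hv : v ∈ s) => exists_integer_norm_sub_lt v (hy v hv) hε
  -- The Chinese remainder theorem merges the local approximants into one integer.
  obtain ⟨r, hr⟩ := IsDedekindDomain.exists_forall_sub_mem_ideal (s := s) (fun v => v.asIdeal) e
    (fun v _ => v.prime) (fun v _ w _ hvw h => hvw (HeightOneSpectrum.ext h)) fun v => q v
  refine ⟨r, fun v hv => ?_⟩
  have h1 := he v _ (hr v hv)
  rw [map_sub] at h1
  have := IsUltrametricDist.norm_add_le_max
    (algebraMap K (v.adicCompletion K) (algebraMap (𝓞 K) K r - algebraMap (𝓞 K) K (q v)))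
    (algebraMap K (v.adicCompletion K) (algebraMap (𝓞 K) K (q v)) - y v)
  rw [norm_algebraMap_adicCompletion, map_sub, sub_add_sub_cancel] at this
  exact this.trans_lt (max_lt h1 (hq v hv))

/-- Representatives of the finite ring `𝓞 K ⧸ v ^ e` form an `ε`-net once `v ^ e` consists of
elements smaller than `ε`. -/
lemma isCompact_closedBall_one_adicCompletion (v : HeightOneSpectrum (𝓞 K)) :
    IsCompact (Metric.closedBall (0 : v.adicCompletion K) 1) := by
  rw [isCompact_iff_totallyBounded_isComplete]
  refine ⟨Metric.totallyBounded_iff.2 fun ε hε => ?_, Metric.isClosed_closedBall.isComplete⟩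
  obtain ⟨e, he⟩ := exists_pow_lt_adicAbv v hε
  have : Finite (𝓞 K ⧸ v.asIdeal ^ e) :=
    Ideal.finiteQuotientOfFreeOfNeBot _ (pow_ne_zero e v.ne_bot)
  refine ⟨Set.range fun c : 𝓞 K ⧸ v.asIdeal ^ e =>
    algebraMap K (v.adicCompletion K) (algebraMap (𝓞 K) K (Quotient.out c)),
    Set.finite_range _, fun y hy => ?_⟩
  obtain ⟨r, hr⟩ := exists_integer_norm_sub_lt v (mem_closedBall_zero_iff.1 hy) hε
  simp only [Set.mem_iUnion, Set.mem_range, exists_exists_eq_and, exists_prop]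
  refine ⟨Ideal.Quotient.mk _ r, ?_⟩
  set q : 𝓞 K := Quotient.out (Ideal.Quotient.mk (v.asIdeal ^ e) r) with hq
  have hqr : q - r ∈ v.asIdeal ^ e := by
    rw [← Ideal.Quotient.eq, hq]
    exact Ideal.Quotient.mk_out _
  have h1 := he _ hqr
  rw [map_sub] at h1
  have := IsUltrametricDist.norm_add_le_max
    (algebraMap K (v.adicCompletion K) (algebraMap (𝓞 K) K q - algebraMap (𝓞 K) K r))
    (algebraMap K (v.adicCompletion K) (algebraMap (𝓞 K) K r) - y)
  rw [norm_algebraMap_adicCompletion, map_sub, sub_add_sub_cancel] at this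
  rw [Metric.mem_ball, dist_comm, dist_eq_norm]
  exact this.trans_lt (max_lt h1 hr)

instance (v : HeightOneSpectrum (𝓞 K)) : ProperSpace (v.adicCompletion K) := by
  have hLC : LocallyCompactSpace (v.adicCompletion K) :=
    (isCompact_closedBall_one_adicCompletion v).locallyCompactSpace_of_mem_nhds_of_addGroup
      (Metric.closedBall_mem_nhds 0 one_pos)
  obtain ⟨c, hc0, hc⟩ := exists_ne_zero_adicAbv_lt v one_pos
  let _ : NontriviallyNormedField (v.adicCompletion K) := .ofNormNeOne
    ⟨algebraMap K _ (algebraMap (𝓞 K) K c), by simpa using hc0, by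
      rw [norm_algebraMap_adicCompletion]
      exact hc.ne⟩
  exact ProperSpace.of_nontriviallyNormedField_of_weaklyLocallyCompactSpace (v.adicCompletion K)

lemma finite_adicAbv_lt_one {x : K} (hx : x ≠ 0) :
    {v : HeightOneSpectrum (𝓞 K) | adicAbv K v x < 1}.Finite := by
  have h := (FinitePlace.hasFiniteMulSupport hx).image FinitePlace.maximalIdeal
  refine h.subset fun v hv => ⟨FinitePlace.mk v, ?_, FinitePlace.maximalIdeal_mk v⟩
  rw [Function.mem_mulSupport, FinitePlace.mk_apply, FinitePlace.norm_embedding]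
  exact (ne_of_lt hv)

end FinitePlaces

/-! ### Archimedean completions -/

section InfinitePlaces

variable {K : Type*} [Field K]

lemma norm_algebraMap_completion (v : InfinitePlace K) (x : K) :
    ‖algebraMap K v.Completion x‖ = v x := by
  rw [InfinitePlace.Completion.algebraMap_apply]
  exact InfinitePlace.Completion.norm_coe v (WithAbs.toAbs v.1 x)

instance (v : InfinitePlace K) : ProperSpace v.Completion := ⟨fun x r => by
  have h := (InfinitePlace.Completion.isometry_extensionEmbedding v)
  have := h.isClosedEmbedding.isCompact_preimage
    (isCompact_closedBall (InfinitePlace.Completion.extensionEmbedding v x) r)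
  rwa [h.preimage_closedBall] at this⟩

end InfinitePlaces

/-! ### Basic facts on the contraction space -/

section ContractionSpace

variable {K : Type*} [Field K] [NumberField K] (lam : K)

lemma finite_finContr (h : lam ≠ 0) : Finite (FinContr lam) :=
  (finite_adicAbv_lt_one h).to_subtype

noncomputable instance : Finite (InfContr lam) := inferInstance

lemma diag_eq_algebraMap (x : K) : diag lam x = algebraMap K (ContractionSpace lam) x := rfl

end ContractionSpace

/-! ### Volumes of balls at Archimedean places -/

section InfiniteHaar

variable {K : Type*} [Field K]

noncomputable instance (v : InfinitePlace K) : MeasurableSpace v.Completion := borel _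

instance (v : InfinitePlace K) : BorelSpace v.Completion := ⟨rfl⟩

lemma exists_isAddHaarMeasure_of_isometry (v : InfinitePlace K) {E : Type*} [NormedAddCommGroup E]
    [NormedSpace ℝ E] [FiniteDimensional ℝ E] (e : v.Completion ≃+ E) (he : Isometry e) :
    ∃ m : Measure v.Completion, m.IsAddHaarMeasure ∧ ∀ r, 0 ≤ r →
      m (Metric.closedBall 0 r) =
        ENNReal.ofReal (r ^ Module.finrank ℝ E) * m (Metric.closedBall 0 1) := by
  borelize E
  let i : v.Completion ≃ᵢ E := ⟨e.toEquiv, he⟩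
  let f : E ≃ₜ+ v.Completion :=
    { e.symm with
      continuous_toFun := i.symm.continuous
      continuous_invFun := i.continuous }
  have hball : ∀ r, f ⁻¹' (Metric.closedBall 0 r) = Metric.closedBall 0 r := by
    intro r
    change i.symm ⁻¹' _ = _
    rw [i.symm.preimage_closedBall]
    congr 1
    exact map_zero e
  have hf : Measurable f := f.continuous.measurable
  refine ⟨(Measure.addHaar : Measure E).map f, f.isAddHaarMeasure_map _, fun r hr => ?_⟩
  rw [Measure.map_apply hf Metric.isClosed_closedBall.measurableSet,
    Measure.map_apply hf Metric.isClosed_closedBall.measurableSet, hball, hball,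
    Measure.addHaar_closedBall' _ _ hr]

lemma exists_isAddHaarMeasure_completion (v : InfinitePlace K) :
    ∃ m : Measure v.Completion, m.IsAddHaarMeasure ∧ ∀ r, 0 ≤ r →
      m (Metric.closedBall 0 r) = ENNReal.ofReal (r ^ v.mult) * m (Metric.closedBall 0 1) := by
  rcases v.isReal_or_isComplex with h | h
  · simpa [InfinitePlace.mult, h] using exists_isAddHaarMeasure_of_isometry v
      (InfinitePlace.Completion.ringEquivRealOfIsReal h).toAddEquiv
      (InfinitePlace.Completion.isometry_extensionEmbeddingOfIsReal h)
  · simpa [InfinitePlace.mult, InfinitePlace.not_isReal_iff_isComplex.2 h] using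
      exists_isAddHaarMeasure_of_isometry v
      (InfinitePlace.Completion.ringEquivComplexOfIsComplex h).toAddEquiv
      (InfinitePlace.Completion.isometry_extensionEmbedding v)

end InfiniteHaar

/-! ### The closure of `ℤ[lam]` at the contracted finite places -/

section IntegralLattice

variable {K : Type*} [Field K] [NumberField K] (lam : K)

/-- The product of the non-Archimedean completions contracted by `lam`. -/
abbrev FinSpace : Type _ := (v : FinContr lam) → v.1.adicCompletion K

/-- The closure of `ℤ[lam]` in the product of the contracted non-Archimedean completions. -/
noncomputable def latticeClosure : Set (FinSpace lam) :=
  closure (algebraMap K (FinSpace lam) '' (Algebra.adjoin ℤ {lam} : Subalgebra ℤ K))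

lemma norm_algebraMap_finSpace (x : K) (v : FinContr lam) :
    ‖algebraMap K (FinSpace lam) x v‖ = HeightOneSpectrum.adicAbv K v.1 x :=
  norm_algebraMap_adicCompletion v.1 x

lemma adicAbv_le_one_of_mem_adjoin (v : HeightOneSpectrum (𝓞 K))
    (hv : HeightOneSpectrum.adicAbv K v lam ≤ 1) {x : K} (hx : x ∈ Algebra.adjoin ℤ {lam}) :
    HeightOneSpectrum.adicAbv K v x ≤ 1 := by
  induction hx using Algebra.adjoin_induction with
  | mem x hx => rwa [Set.mem_singleton_iff.1 hx]
  | algebraMap r => simpa using HeightOneSpectrum.adicAbv_intCast_le_one K v r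
  | add x y _ _ hx hy =>
    exact (HeightOneSpectrum.adicAbv_add_le_max K v x y).trans (max_le hx hy)
  | mul x y _ _ hx hy =>
    rw [map_mul]
    exact mul_le_one₀ hx (apply_nonneg _ _) hy

lemma isCompact_latticeClosure : IsCompact (latticeClosure lam) := by
  refine (isCompact_univ_pi fun v : FinContr lam =>
    isCompact_closedBall (0 : v.1.adicCompletion K) 1).of_isClosed_subset isClosed_closure
    (closure_minimal ?_ (isClosed_set_pi fun _ _ => Metric.isClosed_closedBall))
  rintro _ ⟨x, hx, rfl⟩ v _
  rw [mem_closedBall_zero_iff, norm_algebraMap_finSpace]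
  exact adicAbv_le_one_of_mem_adjoin lam v.1 v.2.le hx

variable {lam}

lemma exists_natCast_mul_mem_adjoin (hgen : IntermediateField.adjoin ℚ {lam} = ⊤) (x : K) :
    ∃ N : ℕ, N ≠ 0 ∧ (N : K) * x ∈ Algebra.adjoin ℤ {lam} := by
  have hx : x ∈ Algebra.adjoin ℚ {lam} := by
    have := IntermediateField.adjoin_simple_toSubalgebra_of_isAlgebraic
      (Algebra.IsAlgebraic.isAlgebraic (R := ℚ) lam)
    rw [← this, hgen]
    trivial
  induction hx using Algebra.adjoin_induction with
  | mem x hx => exact ⟨1, one_ne_zero, by simpa using Algebra.subset_adjoin hx⟩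
  | algebraMap r =>
    refine ⟨r.den, r.den_ne_zero, ?_⟩
    have : (r.den : K) * algebraMap ℚ K r = algebraMap ℤ K r.num := by
      have h : (((r.den : ℚ) * r : ℚ) : K) = ((r.num : ℚ) : K) := by rw [Rat.den_mul_eq_num]
      simpa only [Rat.cast_mul, Rat.cast_natCast, Rat.cast_intCast, eq_ratCast, eq_intCast] using h
    rw [this]
    exact Subalgebra.algebraMap_mem _ _
  | add x y _ _ hx hy =>
    obtain ⟨N, hN, hx⟩ := hx
    obtain ⟨N', hN', hy⟩ := hy
    refine ⟨N * N', mul_ne_zero hN hN', ?_⟩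
    have : ((N * N' : ℕ) : K) * (x + y) = N' * (N * x) + N * (N' * y) := by push_cast; ring
    rw [this]
    exact add_mem (mul_mem (natCast_mem _ _) hx) (mul_mem (natCast_mem _ _) hy)
  | mul x y _ _ hx hy =>
    obtain ⟨N, hN, hx⟩ := hx
    obtain ⟨N', hN', hy⟩ := hy
    refine ⟨N * N', mul_ne_zero hN hN', ?_⟩
    have : ((N * N' : ℕ) : K) * (x * y) = (N * x) * (N' * y) := by push_cast; ring
    rw [this]
    exact mul_mem hx hy

/-- Since `𝓞 K` is finitely generated over `ℤ`, the product of the denominators of its generators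
serves every element. -/
lemma exists_natCast_mul_integer_mem_adjoin (hgen : IntermediateField.adjoin ℚ {lam} = ⊤) :
    ∃ N : ℕ, N ≠ 0 ∧ ∀ r : 𝓞 K, (N : K) * algebraMap (𝓞 K) K r ∈ Algebra.adjoin ℤ {lam} := by
  obtain ⟨s, hs⟩ := (Module.Finite.fg_top : (⊤ : Submodule ℤ (𝓞 K)).FG)
  choose N hN hNs using fun r : 𝓞 K => exists_natCast_mul_mem_adjoin hgen (algebraMap (𝓞 K) K r)
  refine ⟨∏ r ∈ s, N r, Finset.prod_ne_zero_iff.2 fun r _ => hN r, fun r => ?_⟩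
  have hr : r ∈ Submodule.span ℤ (s : Set (𝓞 K)) := hs ▸ Submodule.mem_top
  induction hr using Submodule.span_induction with
  | mem x hx =>
    classical
    rw [← Finset.prod_erase_mul _ _ (Finset.mem_coe.1 hx), Nat.cast_mul, mul_assoc]
    exact mul_mem (natCast_mem _ _) (hNs x)
  | zero => simp
  | add x y _ _ hx hy =>
    rw [map_add, mul_add]
    exact add_mem hx hy
  | smul a x _ hx =>
    rw [zsmul_eq_mul, map_mul, map_intCast, mul_left_comm]
    exact mul_mem (intCast_mem _ _) hx

/-- Some `N ≠ 0` has `N 𝓞 K ⊆ ℤ[lam]`, and integers approximate every point of the unit polydisc;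
hence the closure contains `N` times that polydisc. -/
lemma latticeClosure_mem_nhds_zero (hgen : IntermediateField.adjoin ℚ {lam} = ⊤) (h0 : lam ≠ 0) :
    latticeClosure lam ∈ 𝓝 0 := by
  classical
  have hfin := finite_finContr lam h0
  have := Fintype.ofFinite (FinContr lam)
  obtain ⟨N, hN0, hN⟩ := exists_natCast_mul_integer_mem_adjoin hgen
  have hN0' : (N : K) ≠ 0 := by exact_mod_cast hN0
  have hNv : ∀ v : FinContr lam, algebraMap K (v.1.adicCompletion K) N ≠ 0 := fun v => by
    rw [Ne, map_eq_zero]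
    exact hN0'
  refine Filter.mem_of_superset (set_pi_mem_nhds (s := fun v : FinContr lam =>
    Metric.closedBall (0 : v.1.adicCompletion K) ‖algebraMap K (v.1.adicCompletion K) N‖)
    (Set.toFinite Set.univ) fun v _ =>
      Metric.closedBall_mem_nhds 0 (norm_pos_iff.2 (hNv v))) fun z hz => ?_
  rw [latticeClosure, Metric.mem_closure_iff]
  intro ε hε
  let y : ∀ v : HeightOneSpectrum (𝓞 K), v.adicCompletion K := fun v =>
    if h : HeightOneSpectrum.adicAbv K v lam < 1 then
      (algebraMap K (v.adicCompletion K) N)⁻¹ * z ⟨v, h⟩ else 0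
  have hyv : ∀ v : FinContr lam, y v.1 = (algebraMap K (v.1.adicCompletion K) N)⁻¹ * z v :=
    fun v => dif_pos v.2
  obtain ⟨r, hr⟩ := exists_integer_forall_norm_sub_lt
    (Finset.univ.image fun v : FinContr lam => v.1) y (fun v hv => by
      obtain ⟨w, -, rfl⟩ := Finset.mem_image.1 hv
      rw [hyv, norm_mul, norm_inv, inv_mul_le_one₀ (norm_pos_iff.2 (hNv w))]
      exact mem_closedBall_zero_iff.1 (hz w trivial)) hε
  refine ⟨_, ⟨_, hN r, rfl⟩, (dist_pi_lt_iff hε).2 fun v => ?_⟩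
  have h1 := hr v.1 (Finset.mem_image_of_mem _ (Finset.mem_univ v))
  rw [hyv] at h1
  have h2 : z v = algebraMap K (v.1.adicCompletion K) N *
      ((algebraMap K (v.1.adicCompletion K) N)⁻¹ * z v) := by
    rw [mul_inv_cancel_left₀ (hNv v)]
  have h3 : ‖algebraMap K (v.1.adicCompletion K) N‖ ≤ 1 := by
    rw [norm_algebraMap_adicCompletion]
    exact HeightOneSpectrum.adicAbv_natCast_le_one K v.1 N
  rw [dist_comm, dist_eq_norm, Pi.algebraMap_apply, map_mul, h2, ← mul_sub, norm_mul]
  exact (mul_le_of_le_one_left (norm_nonneg _) h3).trans_lt h1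

omit [NumberField K] in
-- As `p(lam) = 0`, `lam` divides `p(0)` in `ℤ[lam]`, so a constant term matters only modulo `p(0)`.
lemma exists_eq_natCast_add_mul (p : Polynomial ℤ) (hp : Polynomial.aeval lam p = 0)
    (hp0 : p.coeff 0 ≠ 0) {x : K} (hx : x ∈ Algebra.adjoin ℤ {lam}) :
    ∃ k < (p.coeff 0).natAbs, ∃ y ∈ Algebra.adjoin ℤ {lam}, x = k + lam * y := by
  have hsplit : ∀ q : Polynomial ℤ,
      Polynomial.aeval lam q = q.coeff 0 + lam * Polynomial.aeval lam q.divX := by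
    intro q
    conv_lhs => rw [← q.divX_mul_X_add]
    simp [mul_comm, add_comm]
  rw [Algebra.adjoin_singleton_eq_range_aeval] at hx ⊢
  obtain ⟨q, rfl⟩ := hx
  set m := q.coeff 0
  set c := p.coeff 0
  -- The witness comes from subtracting `(m / c) * p`, which vanishes at `lam`, from `q` and
  -- splitting off the constant term.
  refine ⟨(m % c).toNat, ?_, _, ⟨q.divX - Polynomial.C (m / c) * p.divX, rfl⟩, ?_⟩
  · have h1 := Int.emod_nonneg m hp0
    have h2 := Int.emod_lt_abs m hp0
    have h3 : ((m % c).toNat : ℤ) = m % c := Int.toNat_of_nonneg h1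
    zify
    rw [h3]
    exact h2
  · have h1 := Int.emod_nonneg m hp0
    have h2 : (((m % c).toNat : ℤ) : K) = ((m % c : ℤ) : K) := by rw [Int.toNat_of_nonneg h1]
    have h3 : ((m % c : ℤ) : K) = m - c * (m / c : ℤ) := by
      rw [Int.emod_def]
      push_cast
      ring
    rw [Int.cast_natCast] at h2
    change Polynomial.aeval lam q = _ + lam * Polynomial.aeval lam _
    rw [h2, h3, hsplit q]
    have h4 := hsplit p
    rw [hp] at h4
    simp only [map_sub, map_mul, eq_intCast, map_intCast]
    linear_combination (-(m / c : ℤ) : K) * h4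

/-- `ℤ[lam] / lam ℤ[lam]` has at most `|p(0)|` elements, hence so does its completed version. -/
lemma latticeClosure_subset (p : Polynomial ℤ) (hp : Polynomial.aeval lam p = 0)
    (hp0 : p.coeff 0 ≠ 0) :
    latticeClosure lam ⊆ ⋃ k ∈ Finset.range (p.coeff 0).natAbs,
      (fun y => (k : FinSpace lam) + algebraMap K (FinSpace lam) lam * y) '' latticeClosure lam := by
  refine closure_minimal ?_ (isClosed_biUnion_finset fun k _ => ?_)
  · rintro _ ⟨x, hx, rfl⟩
    obtain ⟨k, hk, y, hy, rfl⟩ := exists_eq_natCast_add_mul p hp hp0 hx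
    simp only [Set.mem_iUnion]
    refine ⟨k, Finset.mem_range.2 hk, _, subset_closure ⟨y, hy, rfl⟩, ?_⟩
    simp
  · exact ((isCompact_latticeClosure lam).image (by fun_prop)).isClosed

end IntegralLattice

/-! ### Effect of multiplication by `lam` on Haar measure -/

section HaarScaling

variable {K : Type*} [Field K] [NumberField K] (lam : K)

/-- Multiplication by a nonzero element of `K` on the contraction space. -/
noncomputable def mulEquiv {x : K} (hx : x ≠ 0) : ContractionSpace lam ≃ₜ+ ContractionSpace lam :=
  ContinuousAddEquiv.mulLeft (Units.map (algebraMap K (ContractionSpace lam)) (Units.mk0 x hx))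

@[simp]
lemma mulEquiv_apply {x : K} (hx : x ≠ 0) (a : ContractionSpace lam) :
    mulEquiv lam hx a = diag lam x * a := rfl

/-- The product of the Archimedean completions contracted by `lam`. -/
abbrev InfSpace : Type _ := (v : InfContr lam) → v.1.Completion

/-- The normalized absolute value of `lam` on the contracted Archimedean completions. -/
noncomputable def infModulus : ℝ :=
  ∏ᶠ v : InfContr lam, v.1 lam ^ v.1.mult

/-- By uniqueness, `κ` is a multiple of a product of local Haar measures, and these scale on balls
by `r ^ mult`. -/
lemma isAddHaarMeasure_infSpace_image (κ : Measure (InfSpace lam)) [κ.IsAddHaarMeasure] :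
    κ (Set.univ.pi fun v => Metric.closedBall 0 (v.1 lam)) =
      ENNReal.ofReal (infModulus lam) * κ (Set.univ.pi fun _ => Metric.closedBall 0 1) := by
  classical
  have := Fintype.ofFinite (InfContr lam)
  choose m hm hball using fun v : InfContr lam => exists_isAddHaarMeasure_completion v.1
  rw [Measure.isAddLeftInvariant_eq_smul κ (Measure.pi m)]
  simp only [Measure.smul_apply, Measure.pi_pi, ENNReal.smul_def, smul_eq_mul]
  rw [mul_left_comm, infModulus, finprod_eq_prod_of_fintype,
    ENNReal.ofReal_prod_of_nonneg fun v _ => pow_nonneg (apply_nonneg _ _) _,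
    ← Finset.prod_mul_distrib]
  congr 1
  exact Finset.prod_congr rfl fun v _ => hball v _ (apply_nonneg _ _)

variable {lam}

/-- The test set is the Archimedean unit polydisc times the closure `C` of `ℤ[lam]`. Shrinking the
Archimedean factor by `lam` costs exactly `infModulus`, and `C` is covered by `|p(0)|` translates of
`lam * C`. -/
lemma measure_polydisc_le (hgen : IntermediateField.adjoin ℚ {lam} = ⊤) (h0 : lam ≠ 0)
    (dx : Measure (ContractionSpace lam)) [dx.IsAddHaarMeasure] (p : Polynomial ℤ)
    (hp : Polynomial.aeval lam p = 0) (hp0 : p.coeff 0 ≠ 0) :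
    ∃ S : Set (ContractionSpace lam), dx S ≠ 0 ∧ dx S ≠ ∞ ∧
      ENNReal.ofReal (infModulus lam) * dx S ≤
        (p.coeff 0).natAbs * dx (mulEquiv lam h0 '' S) := by
  classical
  have hfin := finite_finContr lam h0
  have hCc := isCompact_latticeClosure lam
  have hC0 := latticeClosure_mem_nhds_zero hgen h0
  set C := latticeClosure lam
  have hfst : Measurable (Prod.fst : ContractionSpace lam → InfSpace lam) :=
    continuous_fst.measurable
  -- Slicing by `C` yields a Haar measure on the Archimedean factor, so `dx` need not be written as
  -- a product.
  set κ : Measure (InfSpace lam) := (dx.restrict (Set.univ ×ˢ C)).map Prod.fst with hκ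
  have hκD : ∀ D, MeasurableSet D → κ D = dx (D ×ˢ C) := by
    intro D hD
    rw [hκ, Measure.map_apply hfst hD, Measure.restrict_apply (hfst hD)]
    congr 1
    ext ⟨a, b⟩
    simp
  have hinv : κ.IsAddLeftInvariant := ⟨fun a => by
    ext D hD
    have hm : Measurable (a + · : InfSpace lam → InfSpace lam) := measurable_const_add a
    rw [Measure.map_apply hm hD, hκD _ (hm hD), hκD _ hD,
      ← measure_preimage_add dx ((a, 0) : ContractionSpace lam) (D ×ˢ C)]
    congr 1
    ext ⟨b, c⟩
    simp⟩
  have hcpt : IsFiniteMeasureOnCompacts κ := ⟨fun D hD => by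
    rw [hκD D hD.measurableSet]
    exact (hD.prod hCc).measure_lt_top⟩
  have hopen : κ.IsOpenPosMeasure := ⟨fun D hD hDne => by
    rw [hκD D hD.measurableSet]
    obtain ⟨d, hd⟩ := hDne
    exact (Measure.measure_pos_of_mem_nhds dx
      (prod_mem_nhds (hD.mem_nhds hd) hC0)).ne'⟩
  have hhaar : κ.IsAddHaarMeasure := ⟨⟩
  set D : Set (InfSpace lam) := Set.univ.pi fun _ => Metric.closedBall 0 1 with hD
  set D' : Set (InfSpace lam) := Set.univ.pi fun v => Metric.closedBall 0 (v.1 lam) with hD'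
  have hDc : IsCompact D := isCompact_univ_pi fun _ => isCompact_closedBall _ _
  have hD'm : MeasurableSet D' :=
    (isCompact_univ_pi fun _ => isCompact_closedBall _ _).measurableSet
  have hD0 : D ∈ 𝓝 0 := set_pi_mem_nhds (Set.toFinite _) fun v _ =>
    Metric.closedBall_mem_nhds 0 one_pos
  refine ⟨D ×ˢ C, (Measure.measure_pos_of_mem_nhds dx (prod_mem_nhds hD0 hC0)).ne',
    (hDc.prod hCc).measure_lt_top.ne, ?_⟩
  have hscale := isAddHaarMeasure_infSpace_image lam κ
  rw [hκD _ hDc.measurableSet, hκD _ hD'm] at hscale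
  rw [← hscale]
  have hsub : D' ×ˢ C ⊆ ⋃ k ∈ Finset.range (p.coeff 0).natAbs,
      (((0 : InfSpace lam), -(k : FinSpace lam)) + ·) ⁻¹' (mulEquiv lam h0 '' (D ×ˢ C)) := by
    rintro ⟨a, c⟩ ⟨ha, hc⟩
    have := latticeClosure_subset p hp hp0 hc
    simp only [Set.mem_iUnion] at this ⊢
    obtain ⟨k, hk, y, hy, rfl⟩ := this
    refine ⟨k, hk, (algebraMap K (InfSpace lam) lam⁻¹ * a, y), ⟨fun v _ => ?_, hy⟩, ?_⟩
    · have h1 : ‖a v‖ ≤ v.1 lam := mem_closedBall_zero_iff.1 (ha v trivial)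
      have h2 : 0 < v.1 lam := InfinitePlace.pos_iff.2 h0
      rw [mem_closedBall_zero_iff]
      change ‖algebraMap K v.1.Completion lam⁻¹ * a v‖ ≤ 1
      rw [norm_mul, norm_algebraMap_completion, map_inv₀, inv_mul_le_one₀ h2]
      exact h1
    · refine Prod.ext ?_ ?_
      · change algebraMap K (InfSpace lam) lam * (algebraMap K (InfSpace lam) lam⁻¹ * a) = 0 + a
        rw [← mul_assoc, ← map_mul, mul_inv_cancel₀ h0, map_one, one_mul, zero_add]
      · change algebraMap K (FinSpace lam) lam * y = -(k : FinSpace lam) + (k + _)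
        rw [neg_add_cancel_left]
  calc dx (D' ×ˢ C) ≤ ∑ k ∈ Finset.range (p.coeff 0).natAbs,
        dx ((((0 : InfSpace lam), -(k : FinSpace lam)) + ·) ⁻¹' (mulEquiv lam h0 '' (D ×ˢ C))) :=
        (measure_mono hsub).trans (measure_biUnion_finset_le _ _)
    _ = _ := by
        simp_rw [measure_preimage_add]
        rw [Finset.sum_const, Finset.card_range, nsmul_eq_mul]

omit [NumberField K] in
lemma infModulus_pos (h0 : lam ≠ 0) : 0 < infModulus lam :=
  finprod_induction (0 < ·) one_pos (fun _ _ => mul_pos)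
    fun _ => pow_pos (InfinitePlace.pos_iff.2 h0) _

/-- Multiplication by `lam` scales the Haar measure of the contraction space by at least
`∏ |lam|_v / |p(0)|`. -/
lemma measure_le_mul_measure_image (hgen : IntermediateField.adjoin ℚ {lam} = ⊤) (h0 : lam ≠ 0)
    (dx : Measure (ContractionSpace lam)) [dx.IsAddHaarMeasure] (p : Polynomial ℤ)
    (hp : Polynomial.aeval lam p = 0) (hp0 : p.coeff 0 ≠ 0) (S : Set (ContractionSpace lam)) :
    dx S ≤ ENNReal.ofReal ((p.coeff 0).natAbs * (infModulus lam)⁻¹) *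
      dx (mulEquiv lam h0 '' S) := by
  have hfin := finite_finContr lam h0
  have hpos := infModulus_pos h0
  have hmap : ∀ S, (dx.map (mulEquiv lam h0).symm) S = dx (mulEquiv lam h0 '' S) := by
    intro S
    have h := (mulEquiv lam h0).symm.toHomeomorph.toMeasurableEquiv.map_apply (μ := dx) S
    refine h.trans ?_
    congr 1
    ext x
    constructor
    · intro hx
      exact ⟨_, hx, (mulEquiv lam h0).apply_symm_apply x⟩
    · rintro ⟨y, hy, rfl⟩
      change (mulEquiv lam h0).symm (mulEquiv lam h0 y) ∈ S
      rwa [ContinuousAddEquiv.symm_apply_apply]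
  have hH := (mulEquiv lam h0).symm.isAddHaarMeasure_map dx
  -- An automorphism scales Haar measure by a constant, so one test set of finite positive measure
  -- decides the bound.
  set c := (dx.map (mulEquiv lam h0).symm).addHaarScalarFactor dx
  have hc : ∀ S, dx (mulEquiv lam h0 '' S) = c * dx S := by
    intro S
    rw [← hmap, Measure.isAddLeftInvariant_eq_smul (dx.map (mulEquiv lam h0).symm) dx]
    rfl
  obtain ⟨S₀, hS0, hSt, hS⟩ := measure_polydisc_le hgen h0 dx p hp hp0
  rw [hc, ← mul_assoc, ENNReal.mul_le_mul_iff_left hS0 hSt] at hS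
  rw [hc, ← mul_assoc]
  refine le_mul_of_one_le_left zero_le ?_
  rw [mul_comm ((p.coeff 0).natAbs : ℝ), ENNReal.ofReal_mul (by positivity),
    ENNReal.ofReal_natCast, mul_assoc]
  calc (1 : ℝ≥0∞) = ENNReal.ofReal (infModulus lam)⁻¹ * ENNReal.ofReal (infModulus lam) := by
        rw [← ENNReal.ofReal_mul (by positivity), inv_mul_cancel₀ hpos.ne', ENNReal.ofReal_one]
    _ ≤ _ := by gcongr

end HaarScaling

/-! ### Two expressions for the Mahler measure -/

section Mahler

variable {K : Type*} [Field K] [NumberField K] (lam : K)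

lemma exists_intMinpoly_map_eq :
    ∃ c : ℚ, c ≠ 0 ∧ (intMinpoly lam).map (algebraMap ℤ ℚ) = Polynomial.C c * minpoly ℚ lam := by
  set q := IsLocalization.integerNormalization ℤ⁰ (minpoly ℚ lam) with hq
  obtain ⟨b, hb, hbq⟩ := IsLocalization.integerNormalization_spec ℤ⁰ (minpoly ℚ lam)
  rw [← hq] at hbq
  have hm : minpoly ℚ lam ≠ 0 := minpoly.ne_zero (Algebra.IsIntegral.isIntegral lam)
  have hq0 : q ≠ 0 := fun h => hm (IsFractionRing.integerNormalization_eq_zero_iff.1 h)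
  have hc : (q.content : ℚ) ≠ 0 := by
    exact_mod_cast mt Polynomial.content_eq_zero_iff.1 hq0
  have hb0 : (b : ℚ) ≠ 0 := by exact_mod_cast nonZeroDivisors.ne_zero hb
  refine ⟨b / q.content, div_ne_zero hb0 hc, ?_⟩
  have h : Polynomial.C (q.content : ℚ) * (intMinpoly lam).map (algebraMap ℤ ℚ) =
      Polynomial.C (b : ℚ) * minpoly ℚ lam := by
    have h1 := congrArg (Polynomial.map (algebraMap ℤ ℚ)) q.eq_C_content_mul_primPart
    rw [Polynomial.map_mul, Polynomial.map_C, hbq] at h1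
    rw [← Polynomial.smul_eq_C_mul (b : ℚ), Int.cast_smul_eq_zsmul]
    exact h1.symm
  rw [div_eq_inv_mul, Polynomial.C_mul, mul_assoc, ← h, ← mul_assoc, ← Polynomial.C_mul,
    inv_mul_cancel₀ hc, Polynomial.C_1, one_mul]

lemma aeval_intMinpoly : Polynomial.aeval lam (intMinpoly lam) = 0 := by
  obtain ⟨c, -, hc⟩ := exists_intMinpoly_map_eq lam
  rw [← Polynomial.aeval_map_algebraMap ℚ, hc, map_mul, minpoly.aeval, mul_zero]

lemma intMinpoly_ne_zero : intMinpoly lam ≠ 0 := by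
  obtain ⟨c, hc0, hc⟩ := exists_intMinpoly_map_eq lam
  intro h
  rw [h, Polynomial.map_zero] at hc
  exact mul_ne_zero (Polynomial.C_ne_zero.2 hc0)
    (minpoly.ne_zero (Algebra.IsIntegral.isIntegral lam)) hc.symm

variable {lam}

open scoped Classical in
-- A complex place carries two conjugate embeddings and a real one a single embedding, which is the
-- exponent `mult`.
lemma infModulus_eq_prod_embeddings :
    infModulus lam = ∏ σ : K →+* ℂ with ‖σ lam‖ < 1, ‖σ lam‖ := by
  have hv : ∀ w : InfinitePlace K, ∏ σ with InfinitePlace.mk σ = w,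
      (if ‖σ lam‖ < 1 then ‖σ lam‖ else 1) = if w lam < 1 then w lam ^ w.mult else 1 := by
    intro w
    have h : ∀ σ ∈ ({φ | InfinitePlace.mk φ = w} : Finset (K →+* ℂ)),
        (if ‖σ lam‖ < 1 then ‖σ lam‖ else 1) = if w lam < 1 then w lam else 1 := by
      intro σ hσ
      rw [← (Finset.mem_filter.1 hσ).2, InfinitePlace.apply]
    rw [Finset.prod_congr rfl h, Finset.prod_const, InfinitePlace.card_filter_mk_eq]
    split_ifs <;> simp
  rw [Finset.prod_filter, ← Finset.prod_fiberwise Finset.univ InfinitePlace.mk,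
    Finset.prod_congr rfl fun w _ => hv w, ← Finset.prod_filter, infModulus,
    finprod_eq_prod_of_fintype]
  exact (Finset.prod_subtype _ (by simp) fun w : InfinitePlace K => w lam ^ w.mult).symm

/-- This is the scaling constant for `lam⁻¹`: the leading coefficient is the constant term of the
reversed polynomial. -/
lemma mahler_eq_leadingCoeff_mul (h0 : lam ≠ 0) :
    mahler lam = |((intMinpoly lam).leadingCoeff : ℝ)| * (infModulus lam⁻¹)⁻¹ := by
  classical
  rw [mahler, infModulus_eq_prod_embeddings, ← Finset.prod_inv_distrib]
  congr 1
  refine Finset.prod_congr ?_ fun σ _ => by rw [map_inv₀, norm_inv, inv_inv]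
  ext σ
  have hσ : 0 < ‖σ lam‖ := by simpa using h0
  simp [inv_lt_one₀ hσ]

/-- The product of all `|σ(lam)|` is `|p(0) / a_d|` by the norm. No factor equals 1, so dividing out
those below 1 leaves those above 1. -/
lemma mahler_eq_coeff_zero_mul (hgen : IntermediateField.adjoin ℚ {lam} = ⊤) (h0 : lam ≠ 0)
    (hcirc : ∀ σ : K →+* ℂ, ‖σ lam‖ ≠ 1) :
    mahler lam = |((intMinpoly lam).coeff 0 : ℝ)| * (infModulus lam)⁻¹ := by
  classical
  obtain ⟨c, hc0, hc⟩ := exists_intMinpoly_map_eq lam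
  have hint : IsIntegral ℚ lam := Algebra.IsIntegral.isIntegral lam
  have hlc : ((intMinpoly lam).leadingCoeff : ℚ) = c := by
    have h := Polynomial.leadingCoeff_map_of_injective
      (f := algebraMap ℤ ℚ) (RingHom.injective_int _) (intMinpoly lam)
    rw [hc, Polynomial.leadingCoeff_mul, (minpoly.monic hint).leadingCoeff] at h
    simpa using h.symm
  have hcoeff : ((intMinpoly lam).coeff 0 : ℚ) = c * (minpoly ℚ lam).coeff 0 := by
    have h := congrArg (fun q => q.coeff 0) hc
    simpa using h
  have htop : Algebra.adjoin ℚ {lam} = ⊤ := by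
    rw [← IntermediateField.adjoin_simple_toSubalgebra_of_isAlgebraic hint.isAlgebraic, hgen]
    rfl
  have hnorm : |Algebra.norm ℚ lam| = |(minpoly ℚ lam).coeff 0| := by
    have := Algebra.PowerBasis.norm_gen_eq_coeff_zero_minpoly
      (PowerBasis.ofAdjoinEqTop' hint htop)
    rw [PowerBasis.ofAdjoinEqTop'_gen] at this
    rw [this, abs_mul, abs_pow, abs_neg, abs_one, one_pow, one_mul]
  have hprod : ∏ σ : K →+* ℂ, ‖σ lam‖ = |((minpoly ℚ lam).coeff 0 : ℝ)| := by
    have h := InfinitePlace.prod_eq_abs_norm lam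
    rw [hnorm, Rat.cast_abs] at h
    rw [← h, ← Finset.prod_fiberwise Finset.univ InfinitePlace.mk (fun φ => ‖φ lam‖)]
    have (w : InfinitePlace K) (φ) (hφ : φ ∈ ({φ | InfinitePlace.mk φ = w} : Finset _)) :
        ‖φ lam‖ = w lam := by rw [← (Finset.mem_filter.mp hφ).2, InfinitePlace.apply]
    simp_rw [Finset.prod_congr rfl (this _), Finset.prod_const, InfinitePlace.card_filter_mk_eq]
  have hsplit : (∏ σ : K →+* ℂ with 1 < ‖σ lam‖, ‖σ lam‖) * infModulus lam =
      ∏ σ : K →+* ℂ, ‖σ lam‖ := by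
    rw [infModulus_eq_prod_embeddings,
      ← Finset.prod_filter_mul_prod_filter_not Finset.univ (fun σ : K →+* ℂ => 1 < ‖σ lam‖)]
    congr 2
    ext σ
    simp only [Finset.mem_filter, Finset.mem_univ, true_and, not_lt]
    exact ⟨le_of_lt, fun h => lt_of_le_of_ne h (hcirc σ)⟩
  have hlcR : ((intMinpoly lam).leadingCoeff : ℝ) = c := by exact_mod_cast congrArg (Rat.cast : ℚ → ℝ) hlc
  have hcR : ((intMinpoly lam).coeff 0 : ℝ) = c * ((minpoly ℚ lam).coeff 0 : ℚ) := by
    exact_mod_cast congrArg (Rat.cast : ℚ → ℝ) hcoeff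
  rw [mahler, hlcR, hcR, abs_mul, ← hprod, ← hsplit, mul_assoc, mul_assoc,
    mul_inv_cancel₀ (infModulus_pos h0).ne', mul_one]

end Mahler

/-! ### Discreteness of the `S`-integers -/

section Discreteness

open HeightOneSpectrum

variable {K : Type*} [Field K] [NumberField K]

/-- The elements of `K` that are integral at all finite places where `lam` is a unit. -/
noncomputable def sIntegers (lam : K) : AddSubgroup K where
  carrier := {x | ∀ v : HeightOneSpectrum (𝓞 K), adicAbv K v lam = 1 → adicAbv K v x ≤ 1}
  add_mem' {x y} hx hy v hv := (adicAbv_add_le_max K v x y).trans (max_le (hx v hv) (hy v hv))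
  zero_mem' v _ := by simp
  neg_mem' {x} hx v hv := by simpa using hx v hv

lemma zpow_mul_mem_sIntegers {lam : K} (n : ℤ) {x : K} (hx : x ∈ sIntegers lam) :
    lam ^ n * x ∈ sIntegers lam := fun v hv => by
  rw [map_mul, map_zpow₀, hv, one_zpow, one_mul]
  exact hx v hv

lemma intCast_mem_sIntegers (lam : K) (k : ℤ) : (k : K) ∈ sIntegers lam := fun v _ =>
  adicAbv_intCast_le_one K v k

/-- An integer sufficiently divisible at finitely many finite places. -/
lemma exists_natCast_adicAbv_mul_le (s : Finset (HeightOneSpectrum (𝓞 K))) (C : ℝ) :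
    ∃ D : ℕ, D ≠ 0 ∧ ∀ v ∈ s, adicAbv K v (D : K) * C ≤ 1 := by
  have hv : ∀ v : HeightOneSpectrum (𝓞 K), ∃ D : ℕ, D ≠ 0 ∧ adicAbv K v (D : K) * C ≤ 1 := by
    intro v
    set N := Ideal.absNorm v.asIdeal
    have hN : adicAbv K v (N : K) < 1 := by
      have h : adicAbv K v (algebraMap (𝓞 K) K N) < 1 :=
        (v.adicAbv_coe_lt_one_iff (K := K) (one_lt_absNorm_nnreal v) (N : 𝓞 K)).2
          (Ideal.absNorm_mem _)
      rwa [map_natCast] at h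
    have hN0 : N ≠ 0 := by
      have := one_lt_absNorm v
      omega
    obtain ⟨n, hn⟩ := exists_pow_lt_of_lt_one
      (show (0 : ℝ) < (|C| + 1)⁻¹ by positivity) hN
    refine ⟨N ^ n, pow_ne_zero n hN0, ?_⟩
    rw [Nat.cast_pow, map_pow]
    have h1 : 0 ≤ adicAbv K v (N : K) ^ n := pow_nonneg (apply_nonneg _ _) _
    calc adicAbv K v (N : K) ^ n * C ≤ adicAbv K v (N : K) ^ n * (|C| + 1) := by
          gcongr
          linarith [le_abs_self C]
      _ ≤ (|C| + 1)⁻¹ * (|C| + 1) := by gcongr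
      _ = 1 := inv_mul_cancel₀ (by positivity)
  choose D hD0 hD using hv
  refine ⟨∏ v ∈ s, D v, Finset.prod_ne_zero_iff.2 fun v _ => hD0 v, fun v hvs => ?_⟩
  classical
  rw [← Finset.mul_prod_erase s D hvs, Nat.cast_mul, map_mul]
  rcases le_or_gt C 0 with hC | hC
  · exact (mul_nonpos_of_nonneg_of_nonpos (mul_nonneg (apply_nonneg _ _) (apply_nonneg _ _))
      hC).trans zero_le_one
  · refine le_trans ?_ (hD v)
    gcongr
    exact mul_le_of_le_one_right (apply_nonneg _ _) (adicAbv_natCast_le_one K v _)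

/-- A common multiplier `D` turns these elements into algebraic integers with bounded conjugates, of
which there are finitely many. -/
lemma finite_setOf_bounded (s : Finset (HeightOneSpectrum (𝓞 K))) (C : ℝ) :
    {x : K | (∀ w : InfinitePlace K, w x ≤ C) ∧ (∀ v ∈ s, adicAbv K v x ≤ C) ∧
      ∀ v ∉ s, adicAbv K v x ≤ 1}.Finite := by
  obtain ⟨D, hD0, hD⟩ := exists_natCast_adicAbv_mul_le s C
  have hD0' : (D : K) ≠ 0 := by exact_mod_cast hD0
  refine ((Embeddings.finite_of_norm_le K ℂ (D * C)).preimage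
    (f := fun x : K => (D : K) * x) (mul_right_injective₀ hD0').injOn).subset ?_
  rintro x ⟨h1, h2, h3⟩
  refine ⟨?_, fun φ => ?_⟩
  · obtain ⟨r, hr⟩ := mem_range_of_adicAbv_le_one (x := (D : K) * x) fun v => by
      rw [map_mul]
      by_cases hv : v ∈ s
      · exact (mul_le_mul_of_nonneg_left (h2 v hv) (apply_nonneg _ _)).trans (hD v hv)
      · exact mul_le_one₀ (adicAbv_natCast_le_one K v D) (apply_nonneg _ _) (h3 v hv)
    change IsIntegral ℤ ((D : K) * x)
    rw [← hr]
    exact RingOfIntegers.isIntegral_coe r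
  · rw [map_mul, norm_mul, map_natCast, Complex.norm_natCast]
    gcongr
    exact h1 (InfinitePlace.mk φ)

/-- The diagonal embedding of the `S`-integers in the product of the spaces contracted by `lam` and
by `lam'`. -/
noncomputable def diagPair (lam lam' : K) :
    sIntegers lam →+ ContractionSpace lam × ContractionSpace lam' :=
  ((algebraMap K (ContractionSpace lam)).toAddMonoidHom.prod
    (algebraMap K (ContractionSpace lam')).toAddMonoidHom).comp (sIntegers lam).subtype

lemma diagPair_apply (lam lam' : K) (x : sIntegers lam) :
    diagPair lam lam' x = (diag lam x.1, diag lam' x.1) := rfl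

variable {lam lam' : K}

/-- A place with `|lam|_v ≠ 1` is a factor of one of the two spaces, so compactness bounds the
element there. Elsewhere the place is finite, by the hypothesis on conjugates, and `S`-integrality
gives the bound 1. -/
lemma finite_diagPair_preimage (h : lam * lam' = 1) (hcirc : ∀ σ : K →+* ℂ, ‖σ lam‖ ≠ 1)
    {Q : Set (ContractionSpace lam × ContractionSpace lam')} (hQ : IsCompact Q) :
    (diagPair lam lam' ⁻¹' Q).Finite := by
  classical
  have h0 : lam ≠ 0 := left_ne_zero_of_mul_eq_one h
  have h0' : lam' ≠ 0 := right_ne_zero_of_mul_eq_one h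
  have hinv : lam' = lam⁻¹ := eq_inv_of_mul_eq_one_right h
  have hf := finite_finContr lam h0
  have hf' := finite_finContr lam' h0'
  have := Fintype.ofFinite (FinContr lam)
  have := Fintype.ofFinite (FinContr lam')
  obtain ⟨C, hC⟩ : ∃ C, ∀ q ∈ Q, ‖q‖ ≤ C := hQ.isBounded.exists_norm_le
  set s := (finite_adicAbv_lt_one h0).toFinset ∪ (finite_adicAbv_lt_one h0').toFinset with hs
  refine Set.Finite.of_finite_image ((finite_setOf_bounded s C).subset ?_)
    (f := Subtype.val) Subtype.val_injective.injOn
  rintro _ ⟨x, hx, rfl⟩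
  have hxC := hC _ hx
  rw [diagPair_apply, Prod.norm_mk, max_le_iff, diag, diag, Prod.norm_mk, Prod.norm_mk,
    max_le_iff, max_le_iff] at hxC
  obtain ⟨⟨h1, h2⟩, h3, h4⟩ := hxC
  have hC0 : 0 ≤ C := (norm_nonneg _).trans h1
  rw [pi_norm_le_iff_of_nonneg hC0] at h1 h2 h3 h4
  refine ⟨fun w => ?_, fun v hv => ?_, fun v hv => ?_⟩
  · have hw : w lam ≠ 1 := by
      rw [← InfinitePlace.norm_embedding_eq]
      exact hcirc _
    rcases lt_or_gt_of_ne hw with hw | hw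
    · have := h1 ⟨w, hw⟩
      rwa [norm_algebraMap_completion] at this
    · have hw' : w lam' < 1 := by
        rw [hinv, map_inv₀]
        exact inv_lt_one_of_one_lt₀ hw
      have := h3 ⟨w, hw'⟩
      rwa [norm_algebraMap_completion] at this
  · rw [hs, Finset.mem_union, Set.Finite.mem_toFinset, Set.Finite.mem_toFinset] at hv
    rcases hv with hv | hv
    · have := h2 ⟨v, hv⟩
      rwa [norm_algebraMap_adicCompletion] at this
    · have := h4 ⟨v, hv⟩
      rwa [norm_algebraMap_adicCompletion] at this
  · refine x.2 v ?_
    rw [hs, Finset.mem_union, Set.Finite.mem_toFinset, Set.Finite.mem_toFinset, not_or] at hv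
    obtain ⟨hv, hv'⟩ := hv
    refine le_antisymm ?_ (not_lt.1 hv)
    by_contra hlt
    apply hv'
    change adicAbv K v lam' < 1
    rw [hinv, map_inv₀]
    exact inv_lt_one_of_one_lt₀ (not_le.1 hlt)

end Discreteness

/-! ### From discreteness to bounded multiplicity -/

section Multiplicity

/-- Two points of one coset in `Q` differ by a lattice element mapping into the compact set `Q - Q`,
and there are finitely many of these. -/
lemma exists_hasMultiplicityLE {Λ G : Type*} [AddCommGroup Λ] [AddCommGroup G]
    [TopologicalSpace G] [IsTopologicalAddGroup G] (i : Λ →+ G)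
    (hi : ∀ Q : Set G, IsCompact Q → (i ⁻¹' Q).Finite) {Q : Set G} (hQ : IsCompact Q) :
    ∃ N : ℝ≥0∞, N ≠ ∞ ∧ HasMultiplicityLE i Q N := by
  classical
  have hQQ : IsCompact ((fun q : G × G => q.1 - q.2) '' (Q ×ˢ Q)) :=
    (hQ.prod hQ).image (by fun_prop)
  set F := (hi _ hQQ).toFinset
  refine ⟨F.card, by simp, fun z => ?_⟩
  by_cases h : ∃ γ, z + i γ ∈ Q
  · obtain ⟨γ₀, hγ₀⟩ := h
    rw [← (Equiv.addLeft γ₀).tsum_eq, tsum_eq_sum (s := F)]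
    · refine (Finset.sum_le_card_nsmul F _ 1 fun γ _ => ?_).trans (by simp)
      exact Set.indicator_le_self' (by simp) _
    · intro γ hγ
      refine Set.indicator_of_notMem (fun hmem => hγ ?_) _
      rw [Set.Finite.mem_toFinset]
      refine ⟨(_, _), ⟨hmem, hγ₀⟩, ?_⟩
      simp
  · rw [ENNReal.tsum_eq_zero.2 fun γ => Set.indicator_of_notMem (fun hmem => h ⟨γ, hmem⟩) _]
    exact zero_le

end Multiplicity

/-! ### Splitting and reversing partial sums -/

section PartialSum

variable {K : Type*} [Field K] {lam : K}

lemma partialSum_add (s : ℕ → ℤ) (m n : ℕ) :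
    partialSum lam s (m + n) =
      partialSum lam s m + lam ^ m * partialSum lam (fun j => s (m + j)) n := by
  simp only [partialSum, Finset.sum_range_add, Finset.mul_sum, pow_add]
  congr 1
  exact Finset.sum_congr rfl fun j _ => by ring

/-- Reversing the digits turns the exponents `j - n` into `-1, …, -n`, whence the extra factor
`lam'`. It serves twice: to bound `lam ^ (-n) * X_n` in the opposite space and to compare entropies.
-/
lemma partialSum_mul_pow_reflect {lam' : K} (h : lam * lam' = 1) (s : ℕ → ℤ) (n : ℕ) :
    lam' ^ n * partialSum lam s n = lam' * partialSum lam' (fun j => s (n - 1 - j)) n := by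
  simp only [partialSum]
  rw [← Finset.sum_range_reflect (fun j => (s j : K) * lam ^ j), Finset.mul_sum, Finset.mul_sum]
  refine Finset.sum_congr rfl fun j hj => ?_
  have hj' := Finset.mem_range.1 hj
  obtain ⟨m, rfl⟩ : ∃ m, n = j + 1 + m := ⟨n - (j + 1), by omega⟩
  have : j + 1 + m - 1 - j = m := by omega
  rw [this]
  have h1 : lam' ^ m * lam ^ m = 1 := by rw [← mul_pow, mul_comm, h, one_pow]
  calc _ = (s m : K) * lam' * lam' ^ j * (lam' ^ m * lam ^ m) := by ring
    _ = _ := by rw [h1]; ring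

end PartialSum

/-! ### Convergence of the series and contraction by powers of `lam` -/

section Convergence

variable {K : Type*} [Field K] [NumberField K] {lam : K}

lemma diag_add (x y : K) : diag lam (x + y) = diag lam x + diag lam y := by
  simp only [diag_eq_algebraMap, map_add]

lemma diag_mul (x y : K) : diag lam (x * y) = diag lam x * diag lam y := by
  simp only [diag_eq_algebraMap, map_mul]

lemma diag_pow (x : K) (n : ℕ) : diag lam (x ^ n) = diag lam x ^ n := by
  simp only [diag_eq_algebraMap, map_pow]

lemma diag_partialSum (s : ℕ → ℤ) (n : ℕ) :
    diag lam (partialSum lam s n) = ∑ j ∈ Finset.range n, (s j : ContractionSpace lam) *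
      diag lam lam ^ j := by
  simp only [diag_eq_algebraMap, partialSum, map_sum, map_mul, map_pow, map_intCast]

lemma norm_diag_self_lt_one [Fintype (InfContr lam)] [Fintype (FinContr lam)] :
    ‖diag lam lam‖ < 1 := by
  rw [Prod.norm_def, max_lt_iff, pi_norm_lt_iff one_pos, pi_norm_lt_iff one_pos]
  refine ⟨fun v => ?_, fun v => ?_⟩
  · exact (norm_algebraMap_completion v.1 lam).trans_lt v.2
  · exact (norm_algebraMap_adicCompletion v.1 lam).trans_lt v.2

/-- The random series with digits in a finite set converge, uniformly boundedly. -/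
lemma exists_isCompact_limitSum (h0 : lam ≠ 0) (S : Finset ℤ) :
    ∃ Q : Set (ContractionSpace lam), IsCompact Q ∧ ∀ s : ℕ → ℤ, (∀ j, s j ∈ S) →
      Tendsto (fun n => diag lam (partialSum lam s n)) atTop (𝓝 (limitSum lam s)) ∧
      limitSum lam s ∈ Q ∧ ∀ n, diag lam (partialSum lam s n) ∈ Q := by
  have := finite_finContr lam h0
  let _ := Fintype.ofFinite (FinContr lam)
  let _ := Fintype.ofFinite (InfContr lam)
  have hg := summable_norm_geometric_of_norm_lt_one (norm_diag_self_lt_one (lam := lam))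
  set C : ℝ := ∑ k ∈ S, ‖(k : ContractionSpace lam)‖ with hC
  have hle : ∀ s : ℕ → ℤ, (∀ j, s j ∈ S) → ∀ j,
      ‖(s j : ContractionSpace lam) * diag lam lam ^ j‖ ≤ C * ‖diag lam lam ^ j‖ := fun s hs j =>
    (norm_mul_le _ _).trans (mul_le_mul_of_nonneg_right
      (Finset.single_le_sum (f := fun k : ℤ => ‖(k : ContractionSpace lam)‖)
        (fun _ _ => norm_nonneg _) (hs j)) (norm_nonneg _))
  have hC0 : 0 ≤ C := Finset.sum_nonneg fun _ _ => norm_nonneg _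
  refine ⟨Metric.closedBall 0 (C * ∑' j, ‖diag lam lam ^ j‖), isCompact_closedBall _ _,
    fun s hs => ?_⟩
  have hsum : Summable fun j => (s j : ContractionSpace lam) * diag lam lam ^ j :=
    Summable.of_norm_bounded (hg.mul_left C) (hle s hs)
  have ht : Tendsto (fun n => diag lam (partialSum lam s n)) atTop
      (𝓝 (∑' j, (s j : ContractionSpace lam) * diag lam lam ^ j)) := by
    simp only [diag_partialSum]
    exact hsum.hasSum.tendsto_sum_nat
  have ht' := ht
  rw [← ht.limUnder_eq] at ht'
  have hQ : ∀ n, diag lam (partialSum lam s n) ∈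
      Metric.closedBall (0 : ContractionSpace lam) (C * ∑' j, ‖diag lam lam ^ j‖) := fun n => by
    rw [mem_closedBall_zero_iff, diag_partialSum]
    calc _ ≤ ∑ j ∈ Finset.range n, C * ‖diag lam lam ^ j‖ :=
          norm_sum_le_of_le _ fun j _ => hle s hs j
      _ = C * ∑ j ∈ Finset.range n, ‖diag lam lam ^ j‖ := (Finset.mul_sum _ _ _).symm
      _ ≤ _ := mul_le_mul_of_nonneg_left (hg.sum_le_tsum _ fun _ _ => norm_nonneg _) hC0
  exact ⟨ht', Metric.isClosed_closedBall.mem_of_tendsto ht' (Eventually.of_forall hQ), hQ⟩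

lemma limitSum_eq_add (h0 : lam ≠ 0) {S : Finset ℤ} {s : ℕ → ℤ} (hs : ∀ j, s j ∈ S) (m : ℕ) :
    limitSum lam s = diag lam (partialSum lam s m) +
      diag lam (lam ^ m) * limitSum lam (fun j => s (m + j)) := by
  have := finite_finContr lam h0
  obtain ⟨Q, -, hQ⟩ := exists_isCompact_limitSum h0 S
  have h1 := ((hQ s hs).1.comp (tendsto_add_atTop_nat m))
  have h2 := (((hQ (fun j => s (m + j)) fun j => hs _).1).const_mul (diag lam (lam ^ m))).const_add
    (diag lam (partialSum lam s m))
  refine tendsto_nhds_unique h1 (h2.congr fun n => ?_)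
  rw [Function.comp_apply, add_comm n m, partialSum_add, diag_add, diag_mul]

lemma eventually_mulEquiv_image_subset (h0 : lam ≠ 0) {Q : Set (ContractionSpace lam)}
    (hQ : IsCompact Q) {V : Set (ContractionSpace lam)} (hV : V ∈ 𝓝 0) :
    ∀ᶠ n : ℕ in atTop, mulEquiv lam (pow_ne_zero n h0) '' Q ⊆ V := by
  have := finite_finContr lam h0
  let _ := Fintype.ofFinite (FinContr lam)
  let _ := Fintype.ofFinite (InfContr lam)
  obtain ⟨ρ, hρ⟩ := hQ.isBounded.exists_norm_le
  obtain ⟨ε, hε, hεV⟩ := Metric.mem_nhds_iff.1 hV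
  have ht := (summable_norm_geometric_of_norm_lt_one
    (norm_diag_self_lt_one (lam := lam))).tendsto_atTop_zero.mul_const ρ
  rw [zero_mul] at ht
  filter_upwards [ht.eventually (gt_mem_nhds hε)] with n hn
  rintro _ ⟨q, hq, rfl⟩
  refine hεV (mem_ball_zero_iff.2 (lt_of_le_of_lt ?_ hn))
  rw [mulEquiv_apply, diag_pow]
  exact (norm_mul_le _ _).trans (mul_le_mul_of_nonneg_left (hρ q hq) (norm_nonneg _))

lemma tendsto_mulEquiv_zero (h0 : lam ≠ 0) (a : ContractionSpace lam) :
    Tendsto (fun n : ℕ => mulEquiv lam (pow_ne_zero n h0) a) atTop (𝓝 0) := by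
  refine fun V hV => mem_map.2 ?_
  filter_upwards [eventually_mulEquiv_image_subset h0 (isCompact_singleton (x := a)) hV] with n hn
  exact hn ⟨a, rfl, rfl⟩

lemma partialSum_mem_sIntegers (s : ℕ → ℤ) (n : ℕ) : partialSum lam s n ∈ sIntegers lam :=
  sum_mem fun j _ => by
    have := zpow_mul_mem_sIntegers (j : ℤ) (intCast_mem_sIntegers lam (s j))
    rwa [zpow_natCast, mul_comm] at this

end Convergence

/-! ### Splitting an independent sequence at time `m` -/

section Glue

/-- The sequence that agrees with `p.1` before time `m` and with `p.2` from time `m` on. -/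
def glue {E : Type*} (m : ℕ) (p : (ℕ → E) × (ℕ → E)) (j : ℕ) : E :=
  if j < m then p.1 j else p.2 (j - m)

lemma glue_of_lt {E : Type*} {m j : ℕ} (p : (ℕ → E) × (ℕ → E)) (h : j < m) : glue m p j = p.1 j :=
  if_pos h

lemma glue_add {E : Type*} (m j : ℕ) (p : (ℕ → E) × (ℕ → E)) : glue m p (m + j) = p.2 j := by
  simp [glue]

lemma measurable_glue {E : Type*} [MeasurableSpace E] (m : ℕ) :
    Measurable (glue (E := E) m) := by
  refine measurable_pi_lambda _ fun j => ?_
  by_cases h : j < m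
  · simp only [glue, h, if_true]
    fun_prop
  · simp only [glue, h, if_false]
    fun_prop

/-- Gluing independent sequences of independent variables of the same law. -/
lemma map_glue {E : Type*} [MeasurableSpace E] (μ : Measure E) [IsProbabilityMeasure μ] (m : ℕ) :
    ((Measure.infinitePi fun _ : ℕ => μ).prod (Measure.infinitePi fun _ : ℕ => μ)).map (glue m) =
      Measure.infinitePi fun _ : ℕ => μ := by
  refine Measure.eq_infinitePi _ fun u t ht => ?_
  rw [Measure.map_apply (measurable_glue m)
    (MeasurableSet.pi u.countable_toSet fun i _ => ht i)]
  have hpre : glue m ⁻¹' (Set.pi u t) = (Set.pi (u.filter (· < m)) t) ×ˢ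
      (Set.pi ((u.filter fun j => ¬ j < m).image (· - m)) fun j => t (m + j)) := by
    ext p
    simp only [Set.mem_preimage, Set.mem_pi, Set.mem_prod, Finset.coe_filter, Finset.coe_image,
      Set.mem_ofPred_eq, Set.mem_image, Finset.mem_coe]
    constructor
    · refine fun h => ⟨fun j hj => ?_, ?_⟩
      · have := h j hj.1
        rwa [glue_of_lt p hj.2] at this
      · rintro _ ⟨j, hj, rfl⟩
        obtain ⟨k, rfl⟩ := Nat.exists_eq_add_of_le (not_lt.1 hj.2)
        have := h _ hj.1
        rw [glue_add] at this
        simpa using this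
    · rintro ⟨h1, h2⟩ j hj
      by_cases hjm : j < m
      · rw [glue_of_lt p hjm]
        exact h1 j ⟨hj, hjm⟩
      · have := h2 (j - m) ⟨j, ⟨hj, hjm⟩, rfl⟩
        obtain ⟨k, rfl⟩ := Nat.exists_eq_add_of_le (not_lt.1 hjm)
        rw [glue_add]
        simpa using this
  rw [hpre, Measure.prod_prod, Measure.infinitePi_pi _ fun i _ => ht i,
    Measure.infinitePi_pi _ fun i _ => ht _, ← Finset.prod_filter_mul_prod_filter_not u (· < m)]
  congr 1
  rw [Finset.prod_image]
  · refine Finset.prod_congr rfl fun j hj => ?_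
    have := (Finset.mem_filter.1 hj).2
    rw [Nat.add_sub_cancel' (not_lt.1 this)]
  · intro a ha b hb hab
    have h1 := (Finset.mem_filter.1 ha).2
    have h2 := (Finset.mem_filter.1 hb).2
    simp only at hab
    omega

end Glue

/-! ### Entropy of the partial sums -/

section Entropy

variable {K : Type*} [Field K] {lam : K}

lemma shannonEntropy_map {Ω Ω' E : Type*} [MeasurableSpace Ω] [MeasurableSpace Ω'] (P : Measure Ω)
    {g : Ω → Ω'} (hg : Measurable g) {X : Ω' → E} (hX : ∀ x, MeasurableSet (X ⁻¹' {x})) :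
    shannonEntropy (P.map g) X = shannonEntropy P (X ∘ g) := by
  simp only [shannonEntropy, Measure.real, Measure.map_apply hg (hX _), Set.preimage_comp]

lemma shannonEntropy_nonneg {Ω E : Type*} [MeasurableSpace Ω] (P : Measure Ω)
    [IsProbabilityMeasure P] (X : Ω → E) : 0 ≤ shannonEntropy P X :=
  tsum_nonneg fun _ => Real.negMulLog_nonneg measureReal_nonneg measureReal_le_one

lemma measurableSet_partialSum_preimage (n : ℕ) (x : K) :
    MeasurableSet ((fun s : ℕ → ℤ => partialSum lam s n) ⁻¹' {x}) := by
  induction n generalizing x with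
  | zero =>
    simp only [partialSum, Finset.sum_range_zero]
    exact MeasurableSet.const ((0 : K) = x)
  | succ n ih =>
    have : (fun s : ℕ → ℤ => partialSum lam s (n + 1)) ⁻¹' {x} =
        ⋃ k : ℤ, (fun s : ℕ → ℤ => s n) ⁻¹' {k} ∩
          (fun s : ℕ → ℤ => partialSum lam s n) ⁻¹' {x - k * lam ^ n} := by
      ext s
      simp [partialSum, Finset.sum_range_succ, eq_sub_iff_add_eq]
    rw [this]
    exact MeasurableSet.iUnion fun k =>
      ((measurable_pi_apply n) (measurableSet_singleton k)).inter (ih _)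

lemma exists_finset_partialSum_mem (lam : K) (S : Finset ℤ) (n : ℕ) :
    ∃ F : Finset K, ∀ s : ℕ → ℤ, (∀ j, s j ∈ S) → partialSum lam s n ∈ F := by
  classical
  induction n with
  | zero => exact ⟨{0}, fun s _ => by simp [partialSum]⟩
  | succ n ih =>
    obtain ⟨F, hF⟩ := ih
    refine ⟨Finset.image₂ (fun x (k : ℤ) => x + k * lam ^ n) F S, fun s hs => ?_⟩
    have : partialSum lam s (n + 1) = partialSum lam s n + s n * lam ^ n :=
      Finset.sum_range_succ _ _
    rw [this]
    exact Finset.mem_image₂_of_mem (hF s hs) (hs n)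

lemma ae_forall_mem (μ : Measure ℤ) [IsProbabilityMeasure μ] {S : Finset ℤ}
    (hS : ∀ k ∉ S, μ {k} = 0) :
    ∀ᵐ s ∂(Measure.infinitePi fun _ : ℕ => μ), ∀ j, s j ∈ S := by
  have h : ∀ᵐ k ∂μ, k ∈ S := by
    refine (measure_null_iff_singleton (Set.to_countable _)).2 fun k hk => hS k hk
  exact ae_all_iff.2 fun j =>
    (measurePreserving_eval_infinitePi (fun _ : ℕ => μ) j).quasiMeasurePreserving.ae h

lemma partialSum_glue (m : ℕ) (p : (ℕ → ℤ) × (ℕ → ℤ)) :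
    partialSum lam (glue m p) m = partialSum lam p.1 m :=
  Finset.sum_congr rfl fun j hj => by rw [glue_of_lt p (Finset.mem_range.1 hj)]

variable (μ : Measure ℤ) [IsProbabilityMeasure μ] {S : Finset ℤ} (hS : ∀ k ∉ S, μ {k} = 0)
include hS

/-- `X_{m+n}` is a function of `X_m` and an independent copy of `X_n`, built from the shifted
digits. -/
lemma subadditive_shannonEntropy_partialSum :
    Subadditive fun n => shannonEntropy (Measure.infinitePi fun _ : ℕ => μ)
      (fun s => partialSum lam s n) := by
  intro m n
  set π := Measure.infinitePi fun _ : ℕ => μ with hπ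
  set X : (ℕ → ℤ) → K := fun s => partialSum lam s m with hX
  set Y : (ℕ → ℤ) → K := fun s => partialSum lam (fun j => s (m + j)) n with hY
  have hsh : Measurable fun (s : ℕ → ℤ) j => s (m + j) := by fun_prop
  have hXm : ∀ x, MeasurableSet (X ⁻¹' {x}) := measurableSet_partialSum_preimage m
  have hYm : ∀ x, MeasurableSet (Y ⁻¹' {x}) := fun x =>
    hsh (measurableSet_partialSum_preimage n x)
  have hYH : shannonEntropy π Y = shannonEntropy π (fun s => partialSum lam s n) := by
    have h1 : π.map (fun (s : ℕ → ℤ) j => s (m + j)) = π :=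
      Measure.map_infinitePi_infinitePi_of_inj (P := fun _ : ℕ => μ) (add_right_injective m)
    conv_rhs => rw [← h1]
    rw [shannonEntropy_map _ hsh (measurableSet_partialSum_preimage n)]
    rfl
  obtain ⟨F, hF⟩ := exists_finset_partialSum_mem lam S m
  obtain ⟨F', hF'⟩ := exists_finset_partialSum_mem lam S n
  have hXF : ∀ᵐ s ∂π, X s ∈ F := (ae_forall_mem μ hS).mono fun s hs => hF s hs
  have hYF : ∀ᵐ s ∂π, Y s ∈ F' := (ae_forall_mem μ hS).mono fun s hs => hF' _ fun j => hs _
  have hpX : ∀ x, glue m ⁻¹' (X ⁻¹' {x}) = (X ⁻¹' {x}) ×ˢ Set.univ := fun x => by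
    ext p
    simp [hX, partialSum_glue]
  have hpY : ∀ y, glue m ⁻¹' (Y ⁻¹' {y}) =
      Set.univ ×ˢ ((fun s => partialSum lam s n) ⁻¹' {y}) := fun y => by
    ext p
    simp [hY, glue_add]
  have hind : ∀ x y, π (X ⁻¹' {x} ∩ Y ⁻¹' {y}) = π (X ⁻¹' {x}) * π (Y ⁻¹' {y}) := fun x y => by
    have h : ∀ T, MeasurableSet T → π T = (π.prod π) (glue m ⁻¹' T) := fun T hT => by
      conv_lhs => rw [hπ, ← map_glue μ m]
      rw [Measure.map_apply (measurable_glue m) hT]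
    rw [h _ ((hXm x).inter (hYm y)), h _ (hYm y), Set.preimage_inter, hpX, hpY, Set.prod_inter_prod,
      Measure.prod_prod, Measure.prod_prod]
    simp
  have hprod := shannonEntropy_prodMk π hXm hYm hXF hYF hind
  have hFF : ∀ᵐ s ∂π, (X s, Y s) ∈ F ×ˢ F' := by
    filter_upwards [hXF, hYF] with s h h' using Finset.mk_mem_product h h'
  have hcomp := shannonEntropy_comp_le π (X := fun s => (X s, Y s)) (fun z => by
    have : (fun s => (X s, Y s)) ⁻¹' {z} = X ⁻¹' {z.1} ∩ Y ⁻¹' {z.2} := by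
      ext s
      simp [Prod.ext_iff]
    rw [this]
    exact (hXm _).inter (hYm _)) hFF (fun z => z.1 + lam ^ m * z.2)
  have heq : (fun z : K × K => z.1 + lam ^ m * z.2) ∘ (fun s => (X s, Y s)) =
      fun s => partialSum lam s (m + n) := by
    ext s
    simp [hX, hY, partialSum_add]
  rw [heq, hprod, hYH] at hcomp
  exact hcomp

/-- The Garsia entropy is the infimum of the normalized entropies. -/
lemma mul_le_shannonEntropy_partialSum {L : ℝ}
    (hL : Tendsto (fun n : ℕ => shannonEntropy (Measure.infinitePi fun _ : ℕ => μ)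
      (fun s => partialSum lam s n) / n) atTop (𝓝 L)) (n : ℕ) :
    n * L ≤ shannonEntropy (Measure.infinitePi fun _ : ℕ => μ) (fun s => partialSum lam s n) := by
  rcases Nat.eq_zero_or_pos n with rfl | hn
  · simpa using shannonEntropy_nonneg _ _
  have hsub := subadditive_shannonEntropy_partialSum (lam := lam) μ hS
  have hbdd : BddBelow (Set.range fun n : ℕ => shannonEntropy (Measure.infinitePi fun _ : ℕ => μ)
      (fun s => partialSum lam s n) / n) :=
    ⟨0, by rintro _ ⟨n, rfl⟩; exact div_nonneg (shannonEntropy_nonneg _ _) n.cast_nonneg⟩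
  have h := hsub.lim_le_div hbdd hn.ne'
  rw [tendsto_nhds_unique (hsub.tendsto_lim hbdd) hL, le_div_iff₀ (by exact_mod_cast hn)] at h
  linarith

omit hS in
-- Digit reversal preserves the product law, and multiplication by `lam'` and its powers is
-- injective, so neither changes the entropy.
lemma shannonEntropy_partialSum_inv {lam' : K} (h : lam * lam' = 1) (n : ℕ) :
    shannonEntropy (Measure.infinitePi fun _ : ℕ => μ) (fun s => partialSum lam' s n) =
      shannonEntropy (Measure.infinitePi fun _ : ℕ => μ) (fun s => partialSum lam s n) := by
  set π := Measure.infinitePi fun _ : ℕ => μ with hπ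
  have hl' : lam' ≠ 0 := right_ne_zero_of_mul_eq_one h
  -- Fixing the coordinates from `n` on keeps the reindexing injective on all of `ℕ`.
  set f : ℕ → ℕ := fun j => if j < n then n - 1 - j else j with hf
  have hfi : f.Injective := by
    intro a b hab
    simp only [hf] at hab
    split_ifs at hab <;> omega
  have h1 : π.map (fun (s : ℕ → ℤ) j => s (f j)) = π :=
    Measure.map_infinitePi_infinitePi_of_inj (P := fun _ : ℕ => μ) hfi
  have hm : Measurable fun (s : ℕ → ℤ) j => s (f j) := by fun_prop
  conv_lhs => rw [← h1, shannonEntropy_map _ hm (measurableSet_partialSum_preimage n)]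
  rw [← shannonEntropy_comp_injective π _ (mul_right_injective₀ hl'),
    ← shannonEntropy_comp_injective π (fun s => partialSum lam s n)
      (mul_right_injective₀ (pow_ne_zero n hl'))]
  congr 1
  ext s
  simp only [Function.comp_apply]
  rw [partialSum_mul_pow_reflect h]
  congr 1
  exact Finset.sum_congr rfl fun j hj => by simp [hf, Finset.mem_range.1 hj]

end Entropy

/-! ### Absolute continuity of the law of the limit -/

section Law

variable {K : Type*} [Field K] [NumberField K] {lam lam' : K}

lemma measurable_diag_partialSum (h0 : lam ≠ 0) (n : ℕ) :
    Measurable fun s : ℕ → ℤ => diag lam (partialSum lam s n) := by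
  have := finite_finContr lam h0
  simp only [diag_partialSum]
  refine Finset.measurable_sum _ fun j _ => ?_
  exact (measurable_of_countable fun k : ℤ => (k : ContractionSpace lam) * diag lam lam ^ j).comp
    (measurable_pi_apply j)

lemma measurable_limitSum (h0 : lam ≠ 0) :
    Measurable (limitSum lam) := by
  have := finite_finContr lam h0
  have : TopologicalSpace.IsCompletelyMetrizableSpace (ContractionSpace lam) := by
    let _ := Fintype.ofFinite (FinContr lam)
    let _ := Fintype.ofFinite (InfContr lam)
    infer_instance
  exact (StronglyMeasurable.limUnder fun n =>
    (measurable_diag_partialSum h0 n).stronglyMeasurable).measurable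

/-- Multiplication by powers of `lam` on the `S`-integers. -/
noncomputable def sIntegersMul (h0 : lam ≠ 0) (n : ℤ) : sIntegers lam ≃ sIntegers lam where
  toFun x := ⟨lam ^ n * x, zpow_mul_mem_sIntegers n x.2⟩
  invFun x := ⟨lam ^ (-n) * x, zpow_mul_mem_sIntegers (-n) x.2⟩
  left_inv x := Subtype.ext <| by simp [zpow_ne_zero n h0]
  right_inv x := Subtype.ext <| by simp [zpow_ne_zero n h0]

lemma measure_le_pow_mul_measure_image (hgen : IntermediateField.adjoin ℚ {lam} = ⊤) (h0 : lam ≠ 0)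
    (dx : Measure (ContractionSpace lam)) [dx.IsAddHaarMeasure] (p : Polynomial ℤ)
    (hp : Polynomial.aeval lam p = 0) (hp0 : p.coeff 0 ≠ 0) (n : ℕ) (T : Set (ContractionSpace lam)) :
    dx T ≤ ENNReal.ofReal ((|(p.coeff 0 : ℝ)| * (infModulus lam)⁻¹) ^ n) *
      dx (mulEquiv lam (pow_ne_zero n h0) '' T) := by
  induction n generalizing T with
  | zero =>
    have : mulEquiv lam (pow_ne_zero 0 h0) '' T = T := by
      have : ⇑(mulEquiv lam (pow_ne_zero 0 h0)) = id := by
        ext1 x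
        rw [mulEquiv_apply, pow_zero, diag_eq_algebraMap, map_one, one_mul, id]
      rw [this, Set.image_id]
    rw [this, pow_zero, ENNReal.ofReal_one, one_mul]
  | succ n ih =>
    have hM : 0 ≤ |(p.coeff 0 : ℝ)| * (infModulus lam)⁻¹ :=
      mul_nonneg (abs_nonneg _) (inv_nonneg.2 (infModulus_pos h0).le)
    have himg : mulEquiv lam (pow_ne_zero (n + 1) h0) '' T =
        mulEquiv lam h0 '' (mulEquiv lam (pow_ne_zero n h0) '' T) := by
      rw [← Set.image_comp]
      congr 1
      ext1 x
      simp only [mulEquiv_apply, Function.comp_apply, diag_pow]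
      ring
    have h1 := measure_le_mul_measure_image hgen h0 dx p hp hp0
      (mulEquiv lam (pow_ne_zero n h0) '' T)
    rw [Nat.cast_natAbs, Int.cast_abs] at h1
    rw [himg, pow_succ, ENNReal.ofReal_mul (pow_nonneg hM n), mul_assoc]
    exact (ih T).trans (mul_le_mul_right h1 _)

/-- If the entropy of the partial sums is as large as possible, the limit has an absolutely
continuous law. -/
theorem map_limitSum_absolutelyContinuous (h : lam * lam' = 1)
    (hgen : IntermediateField.adjoin ℚ {lam} = ⊤) (hcirc : ∀ σ : K →+* ℂ, ‖σ lam‖ ≠ 1)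
    (dx : Measure (ContractionSpace lam)) [dx.IsAddHaarMeasure]
    (μ : Measure ℤ) [IsProbabilityMeasure μ] {S : Finset ℤ} (hS : ∀ k ∉ S, μ {k} = 0)
    (p : Polynomial ℤ) (hp : Polynomial.aeval lam p = 0) (hp0 : p.coeff 0 ≠ 0)
    (hH : ∀ n : ℕ, n * Real.log (|(p.coeff 0 : ℝ)| * (infModulus lam)⁻¹) ≤
      shannonEntropy (Measure.infinitePi fun _ : ℕ => μ) (fun s => partialSum lam s n)) :
    (Measure.infinitePi fun _ : ℕ => μ).map (limitSum lam) ≪ dx := by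
  classical
  have h0 : lam ≠ 0 := left_ne_zero_of_mul_eq_one h
  have h0' : lam' ≠ 0 := right_ne_zero_of_mul_eq_one h
  have hinv : lam' = lam⁻¹ := eq_inv_of_mul_eq_one_right h
  have := finite_finContr lam h0
  have := finite_finContr lam' h0'
  obtain ⟨Q, hQ, hQs⟩ := exists_isCompact_limitSum h0 S
  obtain ⟨Q', hQ', hQs'⟩ := exists_isCompact_limitSum h0' S
  have hae := ae_forall_mem μ hS
  set Y : ℕ → (ℕ → ℤ) → sIntegers lam := fun n s =>
    ⟨partialSum lam s n, partialSum_mem_sIntegers s n⟩ with hY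
  have hYpre : ∀ n x, Y n ⁻¹' {x} = (fun s => partialSum lam s n) ⁻¹' {x.1} := fun n x => by
    ext s
    simp [hY, Subtype.ext_iff]
  refine map_absolutelyContinuous_of_entropy dx (diagPair lam lam')
    (fun Q hQ => exists_hasMultiplicityLE _ (fun Q hQ => finite_diagPair_preimage h hcirc hQ) hQ)
    (fun n => mulEquiv lam (pow_ne_zero n h0)) (fun n => sIntegersMul h0 n) (fun n γ => ?_)
    (fun Q hQ V hV => eventually_mulEquiv_image_subset h0 hQ hV)
    (M := |(p.coeff 0 : ℝ)| * (infModulus lam)⁻¹)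
    (mul_pos (abs_pos.2 (by exact_mod_cast hp0)) (inv_pos.2 (infModulus_pos h0)))
    (fun n T => measure_le_pow_mul_measure_image hgen h0 dx p hp hp0 n T)
    _ _ (measurable_limitSum h0).aemeasurable Y
    (fun n x => (hYpre n x) ▸ measurableSet_partialSum_preimage n _) (fun n => ?_) hQ
    -- The factor `lam'` is the one produced by reversing the digits.
    (W := (diag lam' lam' * ·) '' Q') (hQ'.image (by fun_prop)) (fun n => ?_) (fun n => ?_)
    (fun n => ?_) (fun n => ?_)
  · change diag lam (lam ^ n) * diag lam γ = diag lam (lam ^ (n : ℤ) * γ)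
    rw [← diag_mul, zpow_natCast]
  · obtain ⟨F, hF⟩ := exists_finset_partialSum_mem lam S n
    refine ⟨F.subtype (· ∈ sIntegers lam), hae.mono fun s hs => ?_⟩
    exact Finset.mem_subtype.2 (hF s hs)
  · filter_upwards [hae] with s hs
    exact ⟨_, (hQs (fun j => s (n + j)) fun j => hs _).2.1, limitSum_eq_add h0 hs n⟩
  · filter_upwards [hae] with s hs using (hQs s hs).2.2 n
  · filter_upwards [hae] with s hs
    refine ⟨_, (hQs' (fun j => s (n - 1 - j)) fun j => hs _).2.2 n, ?_⟩
    change diag lam' lam' * diag lam' (partialSum lam' (fun j => s (n - 1 - j)) n) =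
      diag lam' (lam ^ (-(n : ℤ)) * partialSum lam s n)
    rw [← diag_mul, ← partialSum_mul_pow_reflect h, zpow_neg, zpow_natCast, hinv, inv_pow]
  · refine (hH n).trans_eq ?_
    rw [← shannonEntropy_comp_injective _ (Y n) Subtype.val_injective]
    rfl

end Law

/-! ### From domination by Haar measure to a bounded density -/

section BoundedDensity

variable {X : Type*} [MeasurableSpace X]

lemma exists_bounded_density (α dx : Measure X) [IsFiniteMeasure α] [SigmaFinite dx] {C : ℝ≥0}
    (h : α ≤ C • dx) : α ≪ dx ∧ ∃ (f : X → ℝ≥0∞) (C : ℝ≥0), Measurable f ∧ (∀ x, f x ≤ C) ∧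
      α = dx.withDensity f := by
  have hac : α ≪ dx := (Measure.absolutelyContinuous_of_le h).trans Measure.smul_absolutelyContinuous
  -- Truncation turns the almost everywhere bound into one at every point.
  refine ⟨hac, fun x => min (α.rnDeriv dx x) C, C,
    (Measure.measurable_rnDeriv _ _).min measurable_const, fun x => min_le_right _ _, ?_⟩
  have hle : ∀ᵐ x ∂dx, α.rnDeriv dx x ≤ C := by
    refine ae_le_of_forall_setLIntegral_le_of_sigmaFinite (Measure.measurable_rnDeriv _ _)
      fun s hs _ => ?_
    rw [setLIntegral_const, Measure.setLIntegral_rnDeriv hac]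
    exact h s
  conv_lhs => rw [← Measure.withDensity_rnDeriv_eq α dx hac]
  refine withDensity_congr_ae (hle.mono fun x hx => ?_)
  exact (min_eq_left hx).symm

/-- Test on `U ×ˢ V` for a fixed compact `V` charged by `β` and divide by `β V`; `dy V` is finite.
-/
lemma le_smul_of_prod_le_smul_prod {Y : Type*} [TopologicalSpace Y] [SigmaCompactSpace Y]
    [MeasurableSpace Y] [OpensMeasurableSpace Y] [T2Space Y] {α dx : Measure X} {β dy : Measure Y}
    [SFinite dx] [SigmaFinite dy] [IsFiniteMeasureOnCompacts dy] [IsFiniteMeasure α]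
    [IsFiniteMeasure β] (hβ : β ≠ 0)
    {c : ℝ≥0} (h : α.prod β ≤ c • dx.prod dy) : ∃ C : ℝ≥0, α ≤ C • dx := by
  obtain ⟨n, hn⟩ : ∃ n, β (compactCovering Y n) ≠ 0 := by
    by_contra! hcon
    refine hβ (Measure.measure_univ_eq_zero.1 ?_)
    rw [← iUnion_compactCovering Y]
    exact measure_iUnion_null hcon
  set V := compactCovering Y n
  have hV : IsCompact V := isCompact_compactCovering Y n
  have hβt : β V ≠ ∞ := measure_ne_top _ _
  have hdy : dy V ≠ ∞ := hV.measure_lt_top.ne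
  refine ⟨c * (dy V).toNNReal / (β V).toNNReal, Measure.le_iff.2 fun U _ => ?_⟩
  have h1 := h (U ×ˢ V)
  rw [Measure.smul_apply, Measure.prod_prod, Measure.prod_prod, ENNReal.smul_def, smul_eq_mul] at h1
  have hne : (β V).toNNReal ≠ 0 := by
    simp [ENNReal.toNNReal_eq_zero_iff, hn, hβt]
  rw [Measure.smul_apply, ENNReal.smul_def, smul_eq_mul, ENNReal.coe_div hne, ENNReal.coe_mul,
    ENNReal.coe_toNNReal hdy, ENNReal.coe_toNNReal hβt, ← ENNReal.mul_div_right_comm,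
    ENNReal.le_div_iff_mul_le (Or.inl hn) (Or.inl hβt)]
  calc α U * β V ≤ _ := h1
    _ = _ := by ring

end BoundedDensity

/-! ### Self-similarity and invariance of the periodization -/

section SelfSimilar

variable {Λ G : Type*} [AddCommGroup Λ] [AddCommGroup G] [MeasurableSpace G] [MeasurableAdd G]

/-- Both mixtures consist of the same translated copies of `η` up to lattice vectors, which
periodization does not see. -/
lemma map_periodization_eq_self (i : Λ →+ G) (m η : Measure G) (Θ : G →+ G) (hΘ : Measurable Θ)
    (θ : Λ ≃ Λ) (h : ∀ γ, Θ (i γ) = i (θ γ)) {ι : Type*} (w : ι → ℝ≥0∞) (u v : ι → G)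
    (δ : ι → Λ) (hδ : ∀ k, u k = v k + i (δ k))
    (hm : m = Measure.sum fun k => w k • η.map (· + u k))
    (hmΘ : m.map Θ = Measure.sum fun k => w k • η.map (· + v k)) :
    (periodization i m).map Θ = periodization i m := by
  rw [map_periodization i m Θ hΘ θ h, hmΘ, hm]
  simp only [periodization_sum, periodization_smul]
  congr 1
  ext1 k
  congr 1
  rw [← periodization_map_add i _ (δ k),
    Measure.map_map (measurable_add_const _) (measurable_add_const _)]
  congr 2
  ext z
  simp [hδ, add_assoc]

lemma map_iterate_eq_self {X : Type*} [MeasurableSpace X] {ρ : Measure X} {T : X → X}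
    (hT : Measurable T) (h : ρ.map T = ρ) (n : ℕ) : ρ.map T^[n] = ρ :=
  ((⟨hT, h⟩ : MeasurePreserving T ρ ρ).iterate n).map_eq

/-- The law of a random variable that depends on a sequence of independent letters, decomposed
according to the first letter. -/
lemma map_infinitePi_eq_sum {E : Type*} [Countable E] [MeasurableSpace E] [MeasurableSingletonClass E]
    (μ : Measure E) [IsProbabilityMeasure μ] {f : (ℕ → E) → G} (hf : Measurable f)
    {g : G → G} (hg : Measurable g) (u : E → G)
    (h : ∀ᵐ s ∂(Measure.infinitePi fun _ : ℕ => μ), f s = g (f fun j => s (1 + j)) + u (s 0)) :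
    (Measure.infinitePi fun _ : ℕ => μ).map f = Measure.sum fun k =>
      μ {k} • (((Measure.infinitePi fun _ : ℕ => μ).map f).map g).map (· + u k) := by
  set π := Measure.infinitePi fun _ : ℕ => μ with hπ
  have hjoint : π.map (fun s => (s 0, fun j => s (1 + j))) = μ.prod π := by
    have hm : Measurable fun s : ℕ → E => (s 0, fun j => s (1 + j)) := by fun_prop
    conv_lhs => rw [hπ, ← map_glue μ 1]
    rw [Measure.map_map hm (measurable_glue 1)]
    have : (fun s : ℕ → E => (s 0, fun j => s (1 + j))) ∘ glue 1 = Prod.map (fun s => s 0) id := by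
      ext1 p
      refine Prod.ext (glue_of_lt p one_pos) ?_
      ext j
      exact glue_add 1 j p
    rw [this, ← Measure.map_prod_map _ _ (measurable_pi_apply 0) measurable_id,
      Measure.infinitePi_map_eval, Measure.map_id]
  have hF : Measurable fun p : E × (ℕ → E) => g (f p.2) + u p.1 :=
    measurable_from_prod_countable_right fun k => by
      exact ((hg.comp hf).add_const (u k))
  have h1 : π.map f = (μ.prod π).map fun p => g (f p.2) + u p.1 := by
    rw [← hjoint, Measure.map_map hF (by fun_prop)]
    exact Measure.map_congr h
  conv_lhs => rw [h1, ← Measure.sum_smul_dirac μ, Measure.prod_sum_left,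
    Measure.map_sum hF.aemeasurable]
  congr 1
  ext1 k
  rw [Measure.prod_smul_left, Measure.dirac_prod, Measure.map_smul,
    Measure.map_map hF measurable_prodMk_left, Measure.map_map hg hf,
    Measure.map_map (measurable_add_const _) (hg.comp hf)]
  rfl

end SelfSimilar

/-! ### Domination by Haar measure -/

section Bounded

variable {K : Type*} [Field K] [NumberField K] {lam lam' : K}

lemma countable_numberField (K : Type*) [Field K] [NumberField K] : Countable K :=
  (Module.finBasis ℚ K).equivFun.toEquiv.countable_iff.2 inferInstance

lemma map_limitSum_eq_sum (h0 : lam ≠ 0) (μ : Measure ℤ) [IsProbabilityMeasure μ] {S : Finset ℤ}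
    (hS : ∀ k ∉ S, μ {k} = 0) :
    (Measure.infinitePi fun _ : ℕ => μ).map (limitSum lam) = Measure.sum fun k =>
      μ {k} • (((Measure.infinitePi fun _ : ℕ => μ).map (limitSum lam)).map
        (mulEquiv lam h0)).map (· + diag lam k) := by
  have := finite_finContr lam h0
  refine map_infinitePi_eq_sum μ (measurable_limitSum h0) (mulEquiv lam h0).continuous.measurable
    (fun k => diag lam (k : K)) ?_
  filter_upwards [ae_forall_mem μ hS] with s hs
  rw [limitSum_eq_add h0 hs 1, add_comm, pow_one]
  simp only [partialSum, Finset.sum_range_one, pow_zero, mul_one]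
  rfl

/-- Absolute continuity in both time directions is needed: the Hopf argument takes place on the
product with the past. -/
theorem map_limitSum_le_smul (h : lam * lam' = 1) (hcirc : ∀ σ : K →+* ℂ, ‖σ lam‖ ≠ 1)
    (dx : Measure (ContractionSpace lam)) [dx.IsAddHaarMeasure]
    (dy : Measure (ContractionSpace lam')) [dy.IsAddHaarMeasure]
    (μ : Measure ℤ) [IsProbabilityMeasure μ] {S : Finset ℤ} (hS : ∀ k ∉ S, μ {k} = 0)
    (hα : (Measure.infinitePi fun _ : ℕ => μ).map (limitSum lam) ≪ dx)
    (hβ : (Measure.infinitePi fun _ : ℕ => μ).map (limitSum lam') ≪ dy) :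
    ∃ C : ℝ≥0, (Measure.infinitePi fun _ : ℕ => μ).map (limitSum lam) ≤ C • dx := by
  have h0 : lam ≠ 0 := left_ne_zero_of_mul_eq_one h
  have h0' : lam' ≠ 0 := right_ne_zero_of_mul_eq_one h
  have hinv : lam' = lam⁻¹ := eq_inv_of_mul_eq_one_right h
  have := finite_finContr lam h0
  have := finite_finContr lam' h0'
  have := countable_numberField K
  set π := Measure.infinitePi fun _ : ℕ => μ with hπ
  set α := π.map (limitSum lam) with hαd
  set β := π.map (limitSum lam') with hβd
  have : IsProbabilityMeasure α :=
    Measure.isProbabilityMeasure_map (measurable_limitSum h0).aemeasurable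
  have : IsProbabilityMeasure β :=
    Measure.isProbabilityMeasure_map (measurable_limitSum h0').aemeasurable
  have hg : Measurable (mulEquiv lam h0) := (mulEquiv lam h0).continuous.measurable
  have hg' : Measurable (mulEquiv lam' h0') := (mulEquiv lam' h0').continuous.measurable
  have hgi : Measurable (mulEquiv lam' h0) := (mulEquiv lam' h0).continuous.measurable
  -- The factor `lam'` starts the past at exponent `-1`. The sign makes moving a digit `k` across
  -- the origin a change by `(k, k)`, a diagonal lattice vector.
  set β' := (β.map (mulEquiv lam' h0')).map Neg.neg with hβ'
  have : IsProbabilityMeasure (β.map (mulEquiv lam' h0')) :=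
    Measure.isProbabilityMeasure_map hg'.aemeasurable
  have : IsProbabilityMeasure β' :=
    Measure.isProbabilityMeasure_map measurable_neg.aemeasurable
  have hβ'dy : β' ≪ dy := by
    refine ((hβ.map hg').map measurable_neg).trans ?_
    exact ((Measure.absolutelyContinuous_isAddHaarMeasure (dy.map (mulEquiv lam' h0')) dy).map
      measurable_neg).trans (quasiMeasurePreserving_neg dy).absolutelyContinuous
  have hm : α.prod β' ≪ dx.prod dy := hα.prod hβ'dy
  have hself : α.prod β' = Measure.sum fun k : ℤ => μ {k} •
      ((α.map (mulEquiv lam h0)).prod β').map (· + (diag lam (k : K), 0)) := by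
    conv_lhs => rw [hαd, map_limitSum_eq_sum h0 μ hS, Measure.prod_sum_left]
    congr 1
    ext1 k
    rw [Measure.prod_smul_left]
    congr 1
    conv_lhs => rw [← Measure.map_id (μ := β'),
      Measure.map_prod_map _ _ (measurable_add_const _) measurable_id]
    congr 1
    ext1 z
    exact Prod.ext rfl (add_zero _).symm
  have hβ'i : β'.map (mulEquiv lam' h0) = β.map Neg.neg := by
    rw [hβ', Measure.map_map measurable_neg hg', Measure.map_map hgi (measurable_neg.comp hg')]
    congr 1
    ext1 b
    simp only [Function.comp_apply, mulEquiv_apply, mul_neg, ← mul_assoc, ← diag_mul, h]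
    rw [diag_eq_algebraMap, map_one, one_mul]
  have hβneg : β.map Neg.neg = Measure.sum fun k : ℤ => μ {k} •
      β'.map (· + -diag lam' (k : K)) := by
    conv_lhs => rw [hβd, map_limitSum_eq_sum h0' μ hS, Measure.map_sum measurable_neg.aemeasurable]
    congr 1
    ext1 k
    rw [Measure.map_smul, hβ', Measure.map_map measurable_neg (measurable_add_const _),
      Measure.map_map (measurable_add_const _) measurable_neg]
    congr 2
    ext1 b
    simp [add_comm]
  let T : ContractionSpace lam × ContractionSpace lam' →+ ContractionSpace lam × ContractionSpace lam' :=
    (mulEquiv lam h0).toAddEquiv.toAddMonoidHom.prodMap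
      (mulEquiv lam' h0).toAddEquiv.toAddMonoidHom
  have hTm : Measurable T := hg.prodMap hgi
  have hself' : (α.prod β').map T = Measure.sum fun k : ℤ => μ {k} •
      ((α.map (mulEquiv lam h0)).prod β').map (· + (0, -diag lam' (k : K))) := by
    have : (α.prod β').map T = (α.map (mulEquiv lam h0)).prod (β'.map (mulEquiv lam' h0)) :=
      (Measure.map_prod_map _ _ hg hgi).symm
    rw [this, hβ'i, hβneg, Measure.prod_sum_right]
    congr 1
    ext1 k
    rw [Measure.prod_smul_right]
    congr 1
    conv_lhs => rw [← Measure.map_id (μ := α.map (mulEquiv lam h0)),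
      Measure.map_prod_map _ _ measurable_id (measurable_add_const _)]
    congr 1
    ext1 z
    exact Prod.ext (add_zero _).symm rfl
  have hpow : ∀ (n : ℕ) (γ : sIntegers lam),
      ((mulEquiv lam (pow_ne_zero n h0)) (diagPair lam lam' γ).1,
        (mulEquiv lam' (pow_ne_zero n h0)) (diagPair lam lam' γ).2) =
        diagPair lam lam' (sIntegersMul h0 n γ) := fun n γ => by
    change (diag lam (lam ^ n) * diag lam γ, diag lam' (lam ^ n) * diag lam' γ) =
      (diag lam (lam ^ (n : ℤ) * γ), diag lam' (lam ^ (n : ℤ) * γ))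
    rw [← diag_mul, ← diag_mul, zpow_natCast]
  -- Before applying `T` the digit `k` shifts the first coordinate, afterwards it shifts the second
  -- one by `-k`.
  have hTinv := map_periodization_eq_self (diagPair lam lam') (α.prod β') _ T hTm
    (sIntegersMul h0 1) (fun γ => by
      have := hpow 1 γ
      simp only [mulEquiv_apply, pow_one, Nat.cast_one] at this
      exact this) (fun k => μ {k}) (fun k => (diag lam (k : K), 0))
    (fun k => (0, -diag lam' (k : K))) (fun k => ⟨k, intCast_mem_sIntegers lam k⟩)
    (fun k => by simp [diagPair_apply]) hself hself'
  let Θ : ℕ → (ContractionSpace lam × ContractionSpace lam') ≃ₜ+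
      (ContractionSpace lam × ContractionSpace lam') := fun n =>
    { (mulEquiv lam (pow_ne_zero n h0)).toAddEquiv.prodCongr
        (mulEquiv lam' (pow_ne_zero n h0)).toAddEquiv with
      continuous_toFun := (mulEquiv lam (pow_ne_zero n h0)).continuous.prodMap
        (mulEquiv lam' (pow_ne_zero n h0)).continuous
      continuous_invFun := (mulEquiv lam (pow_ne_zero n h0)).symm.continuous.prodMap
        (mulEquiv lam' (pow_ne_zero n h0)).symm.continuous }
  have hΘT : ∀ n, ⇑(Θ n) = T^[n] := by
    intro n
    ext1 z
    have : ∀ z, T z = (diag lam lam * z.1, diag lam' lam * z.2) := fun z => rfl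
    induction n generalizing z with
    | zero =>
      change (diag lam (lam ^ 0) * z.1, diag lam' (lam ^ 0) * z.2) = z
      simp only [pow_zero, diag_eq_algebraMap, map_one, one_mul]
    | succ n ih =>
      rw [Function.iterate_succ_apply, ← ih, this]
      change (diag lam (lam ^ (n + 1)) * z.1, diag lam' (lam ^ (n + 1)) * z.2) =
        (diag lam (lam ^ n) * (diag lam lam * z.1), diag lam' (lam ^ n) * (diag lam' lam * z.2))
      simp only [pow_succ, diag_mul, mul_assoc]
  have : (dx.prod dy).IsAddHaarMeasure := by
    have : SFinite dx := inferInstance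
    have : SFinite dy := inferInstance
    have : MeasurableAdd (ContractionSpace lam) := inferInstance
    have : MeasurableAdd (ContractionSpace lam') := inferInstance
    exact Measure.prod.instIsAddHaarMeasure dx dy
  have hdec : ∀ x : ContractionSpace lam × ContractionSpace lam', ∃ a b, x = a + b ∧
      Tendsto (fun n => Θ n a) atTop (𝓝 0) ∧ Tendsto (fun n => (Θ n).symm b) atTop (𝓝 0) := by
    refine fun x => ⟨(x.1, 0), (0, x.2), by simp, ?_, ?_⟩
    · have h1 := (tendsto_mulEquiv_zero h0 x.1).prodMk_nhds
        (tendsto_const_nhds (x := (0 : ContractionSpace lam')))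
      refine h1.congr fun n => Prod.ext ?_ ?_
      · rfl
      · exact (map_zero (mulEquiv lam' (pow_ne_zero n h0))).symm
    · have h1 := (tendsto_const_nhds (x := (0 : ContractionSpace lam))).prodMk_nhds
        (tendsto_mulEquiv_zero h0' x.2)
      refine h1.congr fun n => Prod.ext ?_ ?_
      · exact (map_zero (mulEquiv lam (pow_ne_zero n h0)).symm).symm
      · change diag lam' (lam' ^ n) * x.2 = diag lam' (lam ^ n)⁻¹ * x.2
        rw [← inv_pow, ← hinv]
  obtain ⟨c, hc⟩ := exists_le_smul_of_periodization_invariant (dx.prod dy) (α.prod β') hm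
    (diagPair lam lam')
    (fun Q hQ => exists_hasMultiplicityLE _ (fun Q hQ => finite_diagPair_preimage h hcirc hQ) hQ)
    Θ (fun n => sIntegersMul h0 n) (fun n γ => hpow n γ)
    (fun n => by rw [hΘT]; exact map_iterate_eq_self hTm hTinv n) hdec
  exact le_smul_of_prod_le_smul_prod (IsProbabilityMeasure.ne_zero β') hc

end Bounded

/-! ### Both time directions at maximal entropy -/

section MaximalEntropy

variable {K : Type*} [Field K] [NumberField K] {lam : K}

lemma adjoin_inv_eq_top (hgen : IntermediateField.adjoin ℚ {lam} = ⊤) :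
    IntermediateField.adjoin ℚ {lam⁻¹} = ⊤ := by
  rw [eq_top_iff, ← hgen, IntermediateField.adjoin_simple_le_iff]
  simpa using inv_mem (IntermediateField.mem_adjoin_simple_self ℚ lam⁻¹)

lemma exists_map_limitSum_le_smul (hgen : IntermediateField.adjoin ℚ {lam} = ⊤) (h0 : lam ≠ 0)
    (hcirc : ∀ σ : K →+* ℂ, ‖σ lam‖ ≠ 1)
    (dx : Measure (ContractionSpace lam)) [dx.IsAddHaarMeasure]
    (μ : Measure ℤ) [IsProbabilityMeasure μ] {S : Finset ℤ} (hS : ∀ k ∉ S, μ {k} = 0)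
    (hH : Tendsto (fun n : ℕ => shannonEntropy (Measure.infinitePi fun _ : ℕ => μ)
      (fun s => partialSum lam s n) / n) atTop (𝓝 (Real.log (mahler lam)))) :
    ∃ C : ℝ≥0, (Measure.infinitePi fun _ : ℕ => μ).map (limitSum lam) ≤ C • dx := by
  have hi := inv_ne_zero h0
  have hinv : lam * lam⁻¹ = 1 := mul_inv_cancel₀ h0
  have hcirc' : ∀ σ : K →+* ℂ, ‖σ lam⁻¹‖ ≠ 1 := fun σ => by
    rw [map_inv₀, norm_inv, ne_eq, inv_eq_one]
    exact hcirc σ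
  have hlc : (intMinpoly lam).leadingCoeff ≠ 0 :=
    Polynomial.leadingCoeff_ne_zero.2 (intMinpoly_ne_zero lam)
  have hM1 := mahler_eq_leadingCoeff_mul h0
  have hM2 := mahler_eq_coeff_zero_mul hgen h0 hcirc
  -- The leading coefficient formula shows that the Mahler measure is nonzero, so the constant
  -- coefficient in the other formula is too.
  have hc0 : (intMinpoly lam).coeff 0 ≠ 0 := by
    intro h
    rw [hM1, h, Int.cast_zero, abs_zero, zero_mul] at hM2
    exact mul_ne_zero (abs_ne_zero.2 (by exact_mod_cast hlc))
      (inv_ne_zero (infModulus_pos hi).ne') hM2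
  have hrev : (intMinpoly lam).reverse.coeff 0 = (intMinpoly lam).leadingCoeff :=
    Polynomial.coeff_zero_reverse _
  have hrev0 : Polynomial.aeval lam⁻¹ (intMinpoly lam).reverse = 0 := by
    let _ := invertibleOfNonzero h0
    have := (Polynomial.eval₂_reverse_eq_zero_iff (algebraMap ℤ K) lam (intMinpoly lam)).2
      (aeval_intMinpoly lam)
    rwa [invOf_eq_inv] at this
  have hent := mul_le_shannonEntropy_partialSum μ hS hH
  have := finite_finContr lam⁻¹ hi
  refine map_limitSum_le_smul hinv hcirc dx Measure.addHaar μ hS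
    (map_limitSum_absolutelyContinuous hinv hgen hcirc dx μ hS _ (aeval_intMinpoly lam) hc0
      fun n => ?_)
    (map_limitSum_absolutelyContinuous (inv_mul_cancel₀ h0) (adjoin_inv_eq_top hgen) hcirc' _ μ hS _
      hrev0 (hrev ▸ hlc) fun n => ?_)
  · rw [← hM2]
    exact hent n
  · rw [hrev, ← hM1, shannonEntropy_partialSum_inv μ hinv]
    exact hent n

end MaximalEntropy

end MaxEntropy

theorem proposition3p2
    {K : Type*} [Field K] [NumberField K] (lam : K)
    (hgen : IntermediateField.adjoin ℚ {lam} = ⊤) (hne : lam ≠ 0)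
    (hcirc : ∀ σ : K →+* ℂ, ‖σ lam‖ ≠ 1)
    (μ : Measure ℤ) [IsProbabilityMeasure μ] (hfin : ∃ S : Finset ℤ, ∀ k ∉ S, μ {k} = 0)
    {Ω : Type*} [MeasurableSpace Ω] (P : Measure Ω) [IsProbabilityMeasure P]
    (ξ : ℕ → Ω → ℤ) (hmeas : ∀ j, Measurable (ξ j)) (hindep : iIndepFun ξ P)
    (hlaw : ∀ j, P.map (ξ j) = μ)
    (dx : Measure (MaxEntropy.ContractionSpace lam)) [dx.IsAddHaarMeasure] :
    (∀ᵐ ω ∂P, Tendsto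
      (fun n => MaxEntropy.diag lam (MaxEntropy.partialSum lam (fun j => ξ j ω) n)) atTop
      (𝓝 (MaxEntropy.limitSum lam (fun j => ξ j ω)))) ∧
    AEMeasurable (fun ω => MaxEntropy.limitSum lam (fun j => ξ j ω)) P ∧
    (MaxEntropy.IsGarsiaEntropy P lam ξ (Real.log (MaxEntropy.mahler lam)) →
    P.map (fun ω => MaxEntropy.limitSum lam (fun j => ξ j ω)) ≪ dx ∧
    ∃ (f : MaxEntropy.ContractionSpace lam → ℝ≥0∞) (C : ℝ≥0), Measurable f ∧
      (∀ x, f x ≤ C) ∧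
      P.map (fun ω => MaxEntropy.limitSum lam (fun j => ξ j ω)) = dx.withDensity f) := by
  obtain ⟨S, hS⟩ := hfin
  set Z : Ω → ℕ → ℤ := fun ω j => ξ j ω with hZ
  have hZm : Measurable Z := measurable_pi_lambda _ hmeas
  -- Everything depends only on the law of the digit sequence, so the product space may replace `Ω`.
  have hmap : P.map Z = Measure.infinitePi fun _ : ℕ => μ := by
    rw [hindep.map_fun_eq_infinitePi_map hmeas]
    simp_rw [hlaw]
  have hlim := MaxEntropy.measurable_limitSum hne
  have hlaw_lim : P.map (fun ω => MaxEntropy.limitSum lam (fun j => ξ j ω)) =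
      (Measure.infinitePi fun _ : ℕ => μ).map (MaxEntropy.limitSum lam) := by
    rw [← hmap, Measure.map_map hlim hZm]
    rfl
  obtain ⟨Q, -, hQ⟩ := MaxEntropy.exists_isCompact_limitSum hne S
  refine ⟨?_, (hlim.comp hZm).aemeasurable, fun hent => ?_⟩
  · have hae := MaxEntropy.ae_forall_mem μ hS
    rw [← hmap] at hae
    filter_upwards [ae_of_ae_map hZm.aemeasurable hae] with ω hω using (hQ _ hω).1
  · have hent' : Tendsto (fun n : ℕ =>
        MaxEntropy.shannonEntropy (Measure.infinitePi fun _ : ℕ => μ)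
          (fun s => MaxEntropy.partialSum lam s n) / n) atTop
        (𝓝 (Real.log (MaxEntropy.mahler lam))) := by
      refine Tendsto.congr (fun n => ?_) hent
      rw [← hmap, MaxEntropy.shannonEntropy_map P hZm
        (MaxEntropy.measurableSet_partialSum_preimage n)]
      rfl
    obtain ⟨C, hC⟩ := MaxEntropy.exists_map_limitSum_le_smul hgen hne hcirc dx μ hS hent'
    have := MaxEntropy.finite_finContr lam hne
    rw [hlaw_lim]
    have : IsProbabilityMeasure ((Measure.infinitePi fun _ : ℕ => μ).map (MaxEntropy.limitSum lam)) :=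
      Measure.isProbabilityMeasure_map hlim.aemeasurable
    exact MaxEntropy.exists_bounded_density _ dx hC
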